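/- Let $q\ge 2$ be an integer, let $\mathfrak X$ be the $(q+1)$-regular tree with graph distance $d$ and a fixed reference vertex $o$, and let $\tau=\pi/\log q$. Let $\Omega$ be the boundary of $\mathfrak X$, realised as the set of half geodesics $\omega=(o,x_1,x_2,\dots)$ starting at $o$; $[x,\omega)$ is the half geodesic that starts at the vertex $x$ and eventually coincides, up to a shift, with $\omega$. For vertices $x,y$ the cylinder $\Omega(x,y)$ is the set of $\omega$ such that $[x,y]$ is an initial segment of $[x,\omega)$; the cylinders generate the topology of $\Omega$. Let $\nu_x$ be the Borel probability measure on $\Omega$ with $\nu_x(\Omega(x,y))=\frac1{(q+1)q^{n-1}}$ whenever $d(x,y)=n\ge1$, and let $h_\omega(x)=\lim_{m\to\infty}(m-d(x,x_m))$. For $n\in\mathbb N$ put $\Omega_n(x,\omega)=\Omega(x,x_n)$, where $x_n$ is the vertex of $[x,\omega)$ at distance $n$ from $x$, and $$\mathcal E^x_n\eta(\omega)=\frac1{\nu_x(\Omega_n(x,\omega))}\int_{\Omega_n(x,\omega)}\eta\,d\nu_x .$$ Let $d\mu(s)=\frac{q\log q}{4\pi(q+1)}|\mathbf c(s)|^{-2}\,ds$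 on $[0,\tau]$, where $$\mathbf c(z)=\frac{q^{1/2}}{q+1}\,\frac{q^{1/2+iz}-q^{-1/2-iz}}{q^{iz}-q^{-iz}} .$$ Let $S(\mathfrak X\times\mathfrak X)$ be the set of functions $a:\mathfrak X\times\mathfrak X\times\Omega\times[0,\tau]\to\mathbb C$ that are $C^\infty$ in $s\in[0,\tau]$ and such that (1) for all $k\in\mathbb N$ and $x,y\in\mathfrak X$, $(\omega,s)\mapsto\partial_s^ka(x,y,\omega,s)$ is continuous on $\Omega\times[0,\tau]$, and for every $l\in\mathbb N$ there is a constant $C_l$ with $\|(a-\mathcal E^x_na)(x,y,\cdot,\cdot)\|_\infty\le C_l(1+n)^{-l}$ for all $n\in\mathbb N$ and $x,y\in\mathfrak X$; (2) $\partial_s^ka(x,y,\omega,0)=\partial_s^ka(x,y,\omega,\tau)=0$ for all $k\in\mathbb N$, $x,y\in\mathfrak X$ and $\omega\in\Omega$. For $a\in S(\mathfrak X\times\mathfrak X)$ and finitely supported $u:\mathfrak X\to\mathbb C$ let $$\mathrm{OP}(a)u(x)=\sum_{y\in\mathfrak X}\int_\Omega\int_0^\tau q^{(\frac12+is)(h_\omega(y)-h_\omega(x))}\,a(x,y,\omega,s)\,u(y)\,d\mu(s)\,d\nu_x(\omega).$$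 **Theorem.** There is a constant $C>0$, depending only on $q$, such that for every $a\in S(\mathfrak X\times\mathfrak X)$ for which the suprema $\|\partial_s^ka\|_\infty$ of $|\partial_s^ka|$ over $\mathfrak X\times\mathfrak X\times\Omega\times[0,\tau]$, $0\le k\le4$, are finite, the operator $\mathrm{OP}(a)$ extends to a bounded operator from $L^2(\mathfrak X)$ to $L^2(\mathfrak X)$, and $$\|\mathrm{OP}(a)\|_{L^2\to L^2}\le C\Big(\|a\|_{\Omega,4}+\sum_{k=0}^4\|\partial_s^ka\|_\infty\Big),$$ where $\displaystyle\|a\|_{\Omega,4}=\sup_{x,y\in\mathfrak X}\ \sup_{n\in\mathbb N}\ (n+1)^4\,\|(a-\mathcal E^x_na)(x,y,\cdot,\cdot)\|_\infty .$ -/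

import Mathlib

open Set Filter Topology MeasureTheory
open scoped ENNReal NNReal

namespace HomTree

variable {X : Type*}

/-- A half geodesic `(γ 0, γ 1, γ 2, …)` of the graph `G`. -/
def IsGeodesicRay (G : SimpleGraph X) (γ : ℕ → X) : Prop :=
  ∀ i j : ℕ, (G.dist (γ i) (γ j) : ℤ) = |(i : ℤ) - (j : ℤ)|

/-- Two half geodesics meet at infinity: they agree from some point on, up to a shift of the
parameter. -/
def MeetAtInfinity (γ δ : ℕ → X) : Prop :=
  ∃ k l : ℕ, ∀ n : ℕ, γ (n + k) = δ (n + l)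

/-- The boundary `Ω`, realised as the set of half geodesics that start at the reference point `o`. -/
structure Boundary (G : SimpleGraph X) (o : X) where
  /-- The vertices `x_0, x_1, x_2, …` of the half geodesic. -/
  vertex : ℕ → X
  isRay : IsGeodesicRay G vertex
  start : vertex 0 = o

section
variable (G : SimpleGraph X) {o : X}

/-- `γ` is the half geodesic `[x, ω)`, which starts at `x` and is equivalent to `ω`. -/
def IsRayTo (x : X) (ω : Boundary G o) (γ : ℕ → X) : Prop :=
  IsGeodesicRay G γ ∧ γ 0 = x ∧ MeetAtInfinity γ ω.vertex

/-- The cylinder `Ω(x, y)`: the boundary points `ω` for which `[x, ω)` runs through `y`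
(equivalently, since geodesics of a tree are unique, for which `[x, y]` is its initial segment). -/
def cylinder (x y : X) : Set (Boundary G o) :=
  {ω | ∃ γ : ℕ → X, IsRayTo G x ω γ ∧ ∃ n : ℕ, γ n = y}

/-- The set `Ω_n(x, ω) = Ω(x, x_n)`, where `x_n` is the vertex of `[x, ω)` at distance `n`
from `x`. -/
def cylinderAt (x : X) (n : ℕ) (ω : Boundary G o) : Set (Boundary G o) :=
  ⋃ y ∈ {y : X | G.dist x y = n ∧ ω ∈ cylinder G x y}, cylinder G x y

end

/-- The topology of the boundary, generated by the cylinders. -/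
instance (G : SimpleGraph X) (o : X) : TopologicalSpace (Boundary G o) :=
  TopologicalSpace.generateFrom {U | ∃ x y : X, U = cylinder G x y}

instance (G : SimpleGraph X) (o : X) : MeasurableSpace (Boundary G o) := borel _

instance (G : SimpleGraph X) (o : X) : BorelSpace (Boundary G o) := ⟨rfl⟩

/-- `μ` is a Borel probability measure on the boundary which gives each of the `(q + 1) q ^ n`
cylinders `Ω(x, y)`, `d(x, y) = n + 1`, the same mass. -/
def IsVisibilityMeasure (G : SimpleGraph X) (q : ℕ) {o : X} (x : X)
    (μ : Measure (Boundary G o)) : Prop :=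
  IsProbabilityMeasure μ ∧ ∀ (n : ℕ) (y : X), G.dist x y = n + 1 →
    μ (cylinder G x y) = (((q : ℝ≥0∞) + 1) * (q : ℝ≥0∞) ^ n)⁻¹

section existence
variable {G : SimpleGraph X}

lemma pred_unique (hG : G.IsTree) {p v w w' : X} (h : G.Adj w v) (h' : G.Adj w' v)
    (hd : G.dist p v = G.dist p w + 1) (hd' : G.dist p v = G.dist p w' + 1) : w = w' := by
  obtain ⟨P, hP, hPl⟩ := hG.connected.exists_path_of_dist p w
  obtain ⟨P', hP', hPl'⟩ := hG.connected.exists_path_of_dist p w'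
  have e1 : (P.concat h).IsPath :=
    SimpleGraph.Walk.isPath_of_length_eq_dist _ (by rw [SimpleGraph.Walk.length_concat]; omega)
  have e2 : (P'.concat h').IsPath :=
    SimpleGraph.Walk.isPath_of_length_eq_dist _ (by rw [SimpleGraph.Walk.length_concat]; omega)
  have e3 := (hG.existsUnique_path p v).unique e1 e2
  have e4 := congrArg SimpleGraph.Walk.penultimate e3
  simpa using e4

lemma IsGeodesicRay.dist_zero {γ : ℕ → X} (h : IsGeodesicRay G γ) (n : ℕ) :
    G.dist (γ 0) (γ n) = n := by
  have := h 0 n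
  simp at this
  exact_mod_cast this

lemma IsGeodesicRay.adj {γ : ℕ → X} (h : IsGeodesicRay G γ) (n : ℕ) :
    G.Adj (γ n) (γ (n + 1)) := by
  have := h n (n + 1)
  simp at this
  exact this

lemma isGeodesicRay_of (hG : G.IsTree) {γ : ℕ → X} (h : ∀ n, G.Adj (γ n) (γ (n + 1)))
    (h0 : ∀ n, G.dist (γ 0) (γ n) = n) : IsGeodesicRay G γ := by
  have key : ∀ i k, G.dist (γ i) (γ (i + k)) = k := by
    intro i k
    apply le_antisymm
    · induction k with
      | zero => simp
      | succ k ih =>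
        have := hG.connected.dist_triangle (u := γ i) (v := γ (i + k)) (w := γ (i + k + 1))
        have h1 := SimpleGraph.dist_eq_one_iff_adj.2 (h (i + k))
        rw [← add_assoc]
        omega
    · have := hG.connected.dist_triangle (u := γ 0) (v := γ i) (w := γ (i + k))
      rw [h0, h0] at this
      omega
  intro i j
  rcases le_total i j with hij | hij
  · obtain ⟨k, rfl⟩ := Nat.exists_eq_add_of_le hij
    rw [key]; simp
  · obtain ⟨k, rfl⟩ := Nat.exists_eq_add_of_le hij
    rw [SimpleGraph.dist_comm, key]; simp

lemma IsGeodesicRay.ne {γ : ℕ → X} (h : IsGeodesicRay G γ) (n : ℕ) : γ n ≠ γ (n + 2) := by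
  intro e
  have := h n (n + 2)
  rw [← e] at this
  simp at this

/-- Once the distance to `p` grows along a half geodesic, it keeps growing. -/
lemma IsGeodesicRay.grow (hG : G.IsTree) {γ : ℕ → X} (h : IsGeodesicRay G γ) {p : X} {m : ℕ}
    (hm : G.dist p (γ (m + 1)) = G.dist p (γ m) + 1) (k : ℕ) :
    G.dist p (γ (m + k)) = G.dist p (γ m) + k := by
  suffices ∀ k, G.dist p (γ (m + k + 1)) = G.dist p (γ (m + k)) + 1 by
    induction k with
    | zero => simp
    | succ k ih => rw [← add_assoc, this, ih]; ring
  intro k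
  induction k with
  | zero => simpa using hm
  | succ k ih =>
    rcases hG.dist_eq_dist_add_one_of_adj p (h.adj (m + k + 1)) with e | e
    · exact absurd (pred_unique hG (h.adj (m + k)) (h.adj (m + k + 1)).symm ih e) (h.ne _)
    · exact e

/-- A geodesic segment from `δ 0` to a vertex of a half geodesic, followed by the rest of the
half geodesic. -/
lemma splice (hG : G.IsTree) {γ δ : ℕ → X} (h : IsGeodesicRay G γ) {m M : ℕ}
    (hadj : ∀ i < M, G.Adj (δ i) (δ (i + 1))) (hd : ∀ i ≤ M, G.dist (δ 0) (δ i) = i)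
    (he : δ M = γ m) (hgr : ∀ k, G.dist (δ 0) (γ (m + k)) = M + k) :
    ∃ ρ : ℕ → X, IsGeodesicRay G ρ ∧ (∀ i ≤ M, ρ i = δ i) ∧ ∀ k, ρ (k + M) = γ (k + m) := by
  let ρ : ℕ → X := fun i => if i ≤ M then δ i else γ (m + (i - M))
  have h1 : ∀ i ≤ M, ρ i = δ i := fun i hi => by simp [ρ, hi]
  have h2 : ∀ k, ρ (k + M) = γ (k + m) := by
    intro k
    rcases Nat.eq_zero_or_pos k with rfl | hk
    · simp [ρ, he]
    · have : ¬ (k + M ≤ M) := by omega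
      simp [ρ, add_comm]
      omega
  refine ⟨ρ, isGeodesicRay_of hG ?_ ?_, h1, h2⟩
  · intro n
    rcases Nat.lt_or_ge n M with hn | hn
    · rw [h1 n hn.le, h1 (n + 1) hn]; exact hadj n hn
    · obtain ⟨k, rfl⟩ := Nat.exists_eq_add_of_le hn
      have e1 := h2 k
      have e2 := h2 (k + 1)
      rw [show M + k = k + M by ring, show k + M + 1 = k + 1 + M by ring, e1, e2,
        show k + 1 + m = k + m + 1 by ring]
      exact h.adj _
  · intro n
    rw [h1 0 (Nat.zero_le _)]
    rcases Nat.lt_or_ge n M with hn | hn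
    · rw [h1 n hn.le]; exact hd n hn.le
    · obtain ⟨k, rfl⟩ := Nat.exists_eq_add_of_le hn
      rw [show M + k = k + M by ring, h2, show k + m = m + k by ring, hgr]; ring

lemma exists_geodesic (hG : G.IsTree) (x y : X) : ∃ δ : ℕ → X, δ 0 = x ∧ δ (G.dist x y) = y ∧
    (∀ i < G.dist x y, G.Adj (δ i) (δ (i + 1))) ∧ ∀ i ≤ G.dist x y, G.dist x (δ i) = i := by
  obtain ⟨P, -, hPl⟩ := hG.connected.exists_path_of_dist x y
  refine ⟨P.getVert, by simp, by rw [← hPl]; simp, fun i hi => P.adj_getVert_succ (hPl ▸ hi), ?_⟩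
  have hup : ∀ i ≤ G.dist x y, G.dist x (P.getVert i) ≤ i := by
    intro i
    induction i with
    | zero => simp
    | succ i ih =>
      intro hi
      have := hG.connected.dist_triangle (u := x) (v := P.getVert i) (w := P.getVert (i + 1))
      have h1 := SimpleGraph.dist_eq_one_iff_adj.2 (P.adj_getVert_succ (i := i) (by omega))
      have := ih (by omega)
      omega
  have hup' : ∀ k ≤ G.dist x y, G.dist (P.getVert (G.dist x y - k)) y ≤ k := by
    intro k
    induction k with
    | zero => rw [← hPl]; simp
    | succ k ih =>
      intro hk
      have := hG.connected.dist_triangle (u := P.getVert (G.dist x y - (k + 1)))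
        (v := P.getVert (G.dist x y - k)) (w := y)
      have h1 := SimpleGraph.dist_eq_one_iff_adj.2
        (P.adj_getVert_succ (i := G.dist x y - (k + 1)) (by omega))
      rw [show G.dist x y - (k + 1) + 1 = G.dist x y - k by omega] at h1
      have := ih (by omega)
      omega
  intro i hi
  have a1 := hup i hi
  have a2 := hup' (G.dist x y - i) (by omega)
  rw [show G.dist x y - (G.dist x y - i) = i by omega] at a2
  have := hG.connected.dist_triangle (u := x) (v := P.getVert i) (w := y)
  omega

lemma MeetAtInfinity.symm {γ δ : ℕ → X} (h : MeetAtInfinity γ δ) : MeetAtInfinity δ γ := by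
  obtain ⟨k, l, h⟩ := h
  exact ⟨l, k, fun n => (h n).symm⟩

lemma MeetAtInfinity.trans {γ δ ρ : ℕ → X} (h : MeetAtInfinity γ δ) (h' : MeetAtInfinity δ ρ) :
    MeetAtInfinity γ ρ := by
  obtain ⟨k, l, h⟩ := h
  obtain ⟨k', l', h'⟩ := h'
  refine ⟨k + k', l + l', fun n => ?_⟩
  have e1 := h (n + k')
  have e2 := h' (n + l)
  rw [show n + (k + k') = n + k' + k by ring, e1, show n + k' + l = n + l + k' by ring, e2]
  congr 1; ring

/-- For every half geodesic and every vertex `p`, there is an equivalent half geodesic from `p`. -/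
lemma exists_ray (hG : G.IsTree) {γ : ℕ → X} (h : IsGeodesicRay G γ) (p : X) :
    ∃ ρ : ℕ → X, IsGeodesicRay G ρ ∧ ρ 0 = p ∧ MeetAtInfinity ρ γ := by
  obtain ⟨m, hm⟩ : ∃ m, ∀ n, G.dist p (γ m) ≤ G.dist p (γ n) := by
    have hne : (Set.range fun n => G.dist p (γ n)).Nonempty := ⟨_, 0, rfl⟩
    obtain ⟨m, hm⟩ := Nat.sInf_mem hne
    exact ⟨m, fun n => hm.le.trans (Nat.sInf_le ⟨n, rfl⟩)⟩
  have hgr := h.grow hG (p := p) (m := m) (by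
    rcases hG.dist_eq_dist_add_one_of_adj p (h.adj m) with e | e
    · have := hm (m + 1); omega
    · exact e)
  obtain ⟨δ, h0, h1, h2, h3⟩ := exists_geodesic hG p (γ m)
  subst h0
  obtain ⟨ρ, r1, r2, r3⟩ := splice hG h h2 h3 h1 hgr
  exact ⟨ρ, r1, r2 0 (Nat.zero_le _), _, _, r3⟩

/-- Two half geodesics from the same vertex that share a vertex at time `n` agree up to `n`. -/
lemma ray_agree (hG : G.IsTree) {γ δ : ℕ → X} (h : IsGeodesicRay G γ) (h' : IsGeodesicRay G δ)
    (h0 : γ 0 = δ 0) (n : ℕ) (hn : γ n = δ n) : ∀ i ≤ n, γ i = δ i := by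
  induction n with
  | zero => intro i hi; obtain rfl : i = 0 := by omega
            exact h0
  | succ n ih =>
    have : γ n = δ n := by
      refine pred_unique hG (p := γ 0) (h.adj n) (hn ▸ h'.adj n) ?_ ?_
      · rw [h.dist_zero, h.dist_zero]
      · rw [hn, h0, h'.dist_zero, h'.dist_zero]
    intro i hi
    rcases Nat.lt_or_ge n i with hi' | hi'
    · obtain rfl : i = n + 1 := by omega
      exact hn
    · exact ih this i hi'

lemma ray_unique (hG : G.IsTree) {γ δ : ℕ → X} (h : IsGeodesicRay G γ) (h' : IsGeodesicRay G δ)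
    (h0 : γ 0 = δ 0) (hm : MeetAtInfinity γ δ) : γ = δ := by
  obtain ⟨k, l, hkl⟩ := hm
  have : k = l := by
    have e1 := h.dist_zero (0 + k)
    rw [hkl 0, h0, h'.dist_zero] at e1
    omega
  subst this
  funext n
  exact ray_agree hG h h' h0 (n + k) (hkl n) n (by omega)

lemma mem_cylinder_iff (hG : G.IsTree) {o x y : X} {ω : Boundary G o} {γ : ℕ → X}
    (h : IsRayTo G x ω γ) : ω ∈ cylinder G x y ↔ γ (G.dist x y) = y := by
  constructor
  · rintro ⟨δ, ⟨d1, d2, d3⟩, n, rfl⟩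
    have : γ = δ := ray_unique hG h.1 d1 (h.2.1.trans d2.symm) (h.2.2.trans d3.symm)
    subst this
    rw [← d2, d1.dist_zero]
  · intro e
    exact ⟨γ, h, _, e⟩

/-- The cylinders at `x` form a basis of the topology. -/
lemma cylinder_refine (hG : G.IsTree) {o : X} (x x' y' : X) {ω : Boundary G o}
    (hω : ω ∈ cylinder G x' y') : ∃ n₀ : ℕ, ∀ n ≥ n₀, ∀ γ, IsRayTo G x ω γ →
      ω ∈ cylinder G x (γ n) ∧ cylinder (o := o) G x (γ n) ⊆ cylinder G x' y' := by
  obtain ⟨γ₀, g1, g2, g3⟩ := exists_ray hG ω.isRay x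
  obtain ⟨δ, ⟨d1, d2, d3⟩, j, rfl⟩ := hω
  obtain ⟨k, l, hkl⟩ := g3.trans d3.symm
  refine ⟨k + j + 1, fun n hn γ hγ => ?_⟩
  obtain rfl : γ = γ₀ := ray_unique hG hγ.1 g1 (hγ.2.1.trans g2.symm) (hγ.2.2.trans g3.symm)
  refine ⟨⟨γ, hγ, n, rfl⟩, ?_⟩
  rintro ω' ⟨γ', ⟨c1, c2, c3⟩, n', hn'⟩
  have hnn : n' = n := by
    have e := c1.dist_zero n'
    rw [hn', c2, ← g2, g1.dist_zero] at e
    exact e.symm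
  subst hnn
  obtain ⟨i, rfl⟩ : ∃ i, n' = i + 1 + k := ⟨n' - 1 - k, by omega⟩
  have hpred : γ' (i + k) = γ (i + k) :=
    ray_agree hG c1 g1 (c2.trans g2.symm) _ hn' _ (by omega)
  have e1 := hkl i
  have e2 := hkl (i + 1)
  have hgr := c1.grow hG (p := x') (m := i + k) (by
    rw [show i + k + 1 = i + 1 + k by ring, hn', hpred, e1, e2, ← d2, d1.dist_zero,
      d1.dist_zero]
    ring)
  rw [hpred, e1, ← d2, d1.dist_zero] at hgr
  obtain ⟨ρ, r1, r2, r3⟩ := splice hG (δ := δ) (m := i + 1 + k) (M := i + 1 + l) c1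
    (fun i _ => d1.adj i) (fun i _ => d1.dist_zero i) (by rw [hn', e2]) (fun s => by
      rw [show i + 1 + k + s = i + k + (1 + s) by ring, hgr]; ring)
  exact ⟨ρ, ⟨r1, (r2 0 (Nat.zero_le _)).trans d2,
    MeetAtInfinity.trans ⟨_, _, r3⟩ c3⟩, j, r2 j (by omega)⟩

/-- The vertices following `v` on geodesics from `x`. -/
abbrev Child (G : SimpleGraph X) (x v : X) : Type _ :=
  {w : X // G.Adj v w ∧ G.dist x w = G.dist x v + 1}

open Classical in
lemma card_child (hG : G.IsTree) [G.LocallyFinite] {q : ℕ} (hq : G.IsRegularOfDegree (q + 1))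
    (x v : X) : Nat.card (Child G x v) = if v = x then q + 1 else q := by
  have hc : Nat.card (Child G x v) =
      ((G.neighborFinset v).filter fun w => G.dist x w = G.dist x v + 1).card := by
    rw [Child, Nat.subtype_card]
    intro w
    simp
  have hd : (G.neighborFinset v).card = q + 1 := hq v
  rw [hc]
  split_ifs with h
  · subst h
    rw [← hd]
    congr 1
    rw [Finset.filter_eq_self]
    intro w hw
    rw [SimpleGraph.mem_neighborFinset] at hw
    simpa using hw
  · obtain ⟨δ, h0, h1, h2, h3⟩ := exists_geodesic hG x v
    have hpos := hG.connected.pos_dist_of_ne (Ne.symm h)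
    obtain ⟨m, hm⟩ : ∃ m, G.dist x v = m + 1 := ⟨G.dist x v - 1, by omega⟩
    have hadj : G.Adj (δ m) v := by
      have := h2 m (by omega)
      rwa [← hm, h1] at this
    have hdm : G.dist x (δ m) = m := h3 m (by omega)
    have hn : (G.neighborFinset v).filter (fun w => ¬ G.dist x w = G.dist x v + 1) = {δ m} := by
      ext w
      simp only [Finset.mem_filter, SimpleGraph.mem_neighborFinset, Finset.mem_singleton]
      constructor
      · rintro ⟨hw, hw'⟩
        rcases hG.dist_eq_dist_add_one_of_adj x hw with e | e
        · exact pred_unique hG hw.symm hadj e (by omega)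
        · exact absurd e hw'
      · rintro rfl
        exact ⟨hadj.symm, by omega⟩
    have := Finset.card_filter_add_card_filter_not (s := G.neighborFinset v)
      (fun w => G.dist x w = G.dist x v + 1)
    rw [hn, Finset.card_singleton, hd] at this
    omega

/-- The half geodesic from `x` along which every vertex `v` is followed by the child `c v`. -/
def follow (G : SimpleGraph X) (x : X) (c : ∀ v, Child G x v) : ℕ → X
  | 0 => x
  | n + 1 => (c (follow G x c n)).1

lemma dist_follow (x : X) (c : ∀ v, Child G x v) (n : ℕ) : G.dist x (follow G x c n) = n := by
  induction n with
  | zero => simp [follow]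
  | succ n ih =>
    have := (c (follow G x c n)).2.2
    exact this.trans (by rw [ih])

lemma follow_ray (hG : G.IsTree) (x : X) (c : ∀ v, Child G x v) :
    IsGeodesicRay G (follow G x c) :=
  isGeodesicRay_of hG (fun n => (c (follow G x c n)).2.1) (dist_follow x c)

lemma exists_boundary (hG : G.IsTree) (o x : X) (c : ∀ v, Child G x v) :
    ∃ ω : Boundary G o, IsRayTo G x ω (follow G x c) := by
  obtain ⟨ρ, h1, h2, h3⟩ := exists_ray hG (follow_ray hG x c) o
  exact ⟨⟨ρ, h1, h2⟩, follow_ray hG x c, rfl, h3.symm⟩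

lemma finite_sphere (hG : G.IsTree) [G.LocallyFinite] (x : X) (n : ℕ) :
    {y | G.dist x y = n}.Finite := by
  induction n with
  | zero =>
    refine (Set.finite_singleton x).subset fun y hy => ?_
    exact (hG.connected.dist_eq_zero_iff.1 hy).symm
  | succ n ih =>
    refine (ih.biUnion fun v _ => (G.neighborFinset v).finite_toSet).subset fun y hy => ?_
    obtain ⟨δ, h0, h1, h2, h3⟩ := exists_geodesic hG x y
    rw [Set.mem_ofPred_eq] at hy
    refine Set.mem_biUnion (x := δ n) (h3 n (by omega)) ?_
    have := h2 n (by omega)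
    rw [← hy, h1] at this
    simpa using this

lemma countable_vertices (hG : G.IsTree) [G.LocallyFinite] (x : X) : Countable X := by
  rw [← Set.countable_univ_iff]
  refine (Set.countable_iUnion fun n => (finite_sphere hG x n).countable).mono fun y _ => ?_
  exact Set.mem_iUnion.2 ⟨G.dist x y, rfl⟩

/-- On the homogeneous tree of degree `q + 1` the measures `ν_x` exist. -/
theorem exists_isVisibilityMeasure (hG : G.IsTree) [G.LocallyFinite] {q : ℕ} (hq0 : 1 ≤ q)
    (hq : G.IsRegularOfDegree (q + 1)) (o x : X) :
    ∃ μ : Measure (Boundary G o), IsVisibilityMeasure G q x μ := by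
  classical
  have hcX := countable_vertices hG x
  have hcard := fun v => card_child hG hq x v
  have hfin : ∀ v, Finite (Child G x v) := fun v => Nat.finite_of_card_ne_zero (by
    rw [hcard]; split_ifs <;> omega)
  have hne : ∀ v, Nonempty (Child G x v) := fun v => (Nat.card_ne_zero.1 (by
    rw [hcard]; split_ifs <;> omega)).1
  let : ∀ v, Fintype (Child G x v) := fun v => Fintype.ofFinite _
  let : ∀ v, MeasurableSpace (Child G x v) := fun v => ⊤
  let κ : ∀ v, Measure (Child G x v) := fun v => (PMF.uniformOfFintype (Child G x v)).toMeasure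
  have hκ : ∀ v w, κ v {w} = ((if v = x then q + 1 else q : ℕ) : ℝ≥0∞)⁻¹ := by
    intro v w
    rw [PMF.toMeasure_apply_singleton _ _ MeasurableSpace.measurableSet_top, PMF.uniformOfFintype_apply,
      ← Nat.card_eq_fintype_card, hcard]
  have : ∀ v, IsProbabilityMeasure (κ v) := fun v => by dsimp only [κ]; infer_instance
  let P := Measure.infinitePi κ
  choose Φ hΦ using exists_boundary hG o x
  -- the event that the random half geodesic runs through `y`
  have hev : ∀ y, Φ ⁻¹' cylinder G x y = {c | follow G x c (G.dist x y) = y} := fun y => by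
    ext c
    exact mem_cylinder_iff hG (hΦ c)
  have hpi : ∀ y, ∃ p : ℕ → X, p 0 = x ∧ p (G.dist x y) = y ∧
      (∀ i ≤ G.dist x y, G.dist x (p i) = i) ∧ (∀ i < G.dist x y, G.Adj (p i) (p (i + 1))) ∧
      {c | follow G x c (G.dist x y) = y} =
      Set.pi ((Finset.range (G.dist x y)).image p : Finset X)
        (fun v => {w : Child G x v | w.1 = p (G.dist x v + 1)}) := by
    intro y
    obtain ⟨p, h0, h1, h2, h3⟩ := exists_geodesic hG x y
    refine ⟨p, h0, h1, h3, h2, ?_⟩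
    ext c
    simp only [Set.mem_ofPred_eq, Set.mem_pi, Finset.coe_image, Finset.coe_range,
      Set.forall_mem_image, Set.mem_Iio]
    constructor
    · intro h
      have hag : ∀ k ≤ G.dist x y, follow G x c (G.dist x y - k) = p (G.dist x y - k) := by
        intro k
        induction k with
        | zero => intro _; simpa [h1] using h
        | succ k ih =>
          intro hk
          have ih' := ih (by omega)
          obtain ⟨n, hn⟩ : ∃ n, G.dist x y - k = n + 1 := ⟨G.dist x y - k - 1, by omega⟩
          rw [hn] at ih'
          rw [show G.dist x y - (k + 1) = n by omega]
          refine pred_unique hG (p := x) ((follow_ray hG x c).adj n)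
            (ih' ▸ h2 n (by omega)) ?_ ?_
          · rw [dist_follow, dist_follow]
          · rw [dist_follow, h3 n (by omega)]
      intro i hi
      refine Eq.trans ?_ (congrArg (fun k => p (k + 1)) (h3 i hi.le).symm)
      have e1 := hag (G.dist x y - i) (by omega)
      have e2 := hag (G.dist x y - (i + 1)) (by omega)
      rw [show G.dist x y - (G.dist x y - i) = i by omega] at e1
      rw [show G.dist x y - (G.dist x y - (i + 1)) = i + 1 by omega] at e2
      change _ = p (i + 1)
      rw [← e2, ← e1]
      rfl
    · intro h
      have hag : ∀ i ≤ G.dist x y, follow G x c i = p i := by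
        intro i
        induction i with
        | zero => intro _; exact h0.symm
        | succ i ih =>
          intro hi
          have e : _ = p (i + 1) :=
            (h (x := i) (by omega)).trans (congrArg (fun k => p (k + 1)) (h3 i (by omega)))
          rw [← e, ← ih (by omega)]
          rfl
      rw [hag _ le_rfl, h1]
  have hmeas : ∀ y, MeasurableSet (Φ ⁻¹' cylinder G x y) := by
    intro y
    obtain ⟨p, -, -, -, -, h⟩ := hpi y
    rw [hev, h]
    exact MeasurableSet.pi (Finset.countable_toSet _) fun _ _ => MeasurableSpace.measurableSet_top
  have hΦm : Measurable Φ := by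
    have hb : ∀ U ∈ {U : Set (Boundary G o) | ∃ x y : X, U = cylinder G x y},
        MeasurableSet (Φ ⁻¹' U) := by
      rintro U ⟨x', y', rfl⟩
      have : Φ ⁻¹' cylinder G x' y' = ⋃ y ∈ {y | cylinder (o := o) G x y ⊆ cylinder G x' y'},
          Φ ⁻¹' cylinder G x y := by
        ext c
        simp only [Set.mem_iUnion, Set.mem_ofPred_eq, Set.mem_preimage]
        constructor
        · intro hc
          obtain ⟨n, hn⟩ := cylinder_refine hG x x' y' hc
          obtain ⟨h1, h2⟩ := hn n le_rfl _ (hΦ c)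
          exact ⟨_, h2, h1⟩
        · rintro ⟨y, hy, h⟩
          exact hy h
      rw [this]
      exact MeasurableSet.biUnion (Set.to_countable _) fun y _ => hmeas y
    have hsc : SecondCountableTopology (Boundary G o) := by
      refine ⟨{U | ∃ x y : X, U = cylinder G x y}, ?_, rfl⟩
      refine (Set.countable_range fun p : X × X => cylinder (o := o) G p.1 p.2).mono ?_
      rintro U ⟨x, y, rfl⟩
      exact ⟨(x, y), rfl⟩
    have hbor : (inferInstance : MeasurableSpace (Boundary G o)) =
        MeasurableSpace.generateFrom {U | ∃ x y : X, U = cylinder G x y} :=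
      borel_eq_generateFrom_of_subbasis rfl
    have := measurable_generateFrom (f := Φ) hb
    rwa [← hbor] at this
  refine ⟨P.map Φ, Measure.isProbabilityMeasure_map hΦm.aemeasurable, fun n y hy => ?_⟩
  have hcm : MeasurableSet (cylinder (o := o) G x y) :=
    by
    refine IsOpen.measurableSet ?_
    exact TopologicalSpace.isOpen_generateFrom_of_mem ⟨x, y, rfl⟩
  rw [Measure.map_apply hΦm hcm, hev]
  obtain ⟨p, h0, h1, h3, h2, h⟩ := hpi y
  have hinj : Set.InjOn p (Finset.range (G.dist x y)) := by
    intro i hi j hj e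
    simp only [Finset.coe_range, Set.mem_Iio] at hi hj
    rw [← h3 i hi.le, ← h3 j hj.le, e]
  rw [h, Measure.infinitePi_pi _ fun _ _ => MeasurableSpace.measurableSet_top, Finset.prod_image hinj]
  have hterm : ∀ i ∈ Finset.range (G.dist x y),
      κ (p i) {w : Child G x (p i) | w.1 = p (G.dist x (p i) + 1)} =
        ((if i = 0 then q + 1 else q : ℕ) : ℝ≥0∞)⁻¹ := by
    intro i hi
    rw [Finset.mem_range] at hi
    have hs : {w : Child G x (p i) | w.1 = p (G.dist x (p i) + 1)} =
        {⟨p (i + 1), h2 i hi, by rw [h3 _ hi, h3 _ hi.le]⟩} := by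
      ext w
      have e : p (G.dist x (p i) + 1) = p (i + 1) := congrArg (fun k => p (k + 1)) (h3 i hi.le)
      exact ⟨fun hw => Subtype.ext (Eq.trans hw e),
        fun hw => (congrArg Subtype.val hw).trans e.symm⟩
    have hx : p i = x ↔ i = 0 := by
      have e := h3 i hi.le
      constructor
      · intro hpx
        rw [hpx] at e
        simpa using e.symm
      · rintro rfl
        exact h0
    rw [hs, hκ]
    simp only [hx]
  rw [Finset.prod_congr rfl hterm, hy, Finset.prod_range_succ']
  simp only [Nat.add_eq_zero_iff, one_ne_zero, and_false, if_false, if_true, Finset.prod_const,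
    Finset.card_range]
  rw [ENNReal.mul_inv (by left; positivity) (by left; finiteness), ENNReal.inv_pow, mul_comm]
  push_cast
  rfl

end existence

open Classical in
/-- The measure `ν_x` on the boundary. It exists on every homogeneous tree, by
`exists_isVisibilityMeasure`; elsewhere the value is irrelevant. -/
noncomputable def visibilityMeasure (G : SimpleGraph X) (q : ℕ) (o x : X) :
    Measure (Boundary G o) :=
  if h : ∃ μ : Measure (Boundary G o), IsVisibilityMeasure G q x μ then h.choose else 0

theorem isVisibilityMeasure_visibilityMeasure {G : SimpleGraph X} (hG : G.IsTree)
    [G.LocallyFinite] {q : ℕ} (hq0 : 1 ≤ q) (hq : G.IsRegularOfDegree (q + 1)) (o x : X) :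
    IsVisibilityMeasure G q x (visibilityMeasure G q o x) := by
  have h := exists_isVisibilityMeasure hG hq0 hq o x
  rw [visibilityMeasure, dif_pos h]
  exact h.choose_spec

/-- The height function `h_ω(x) = lim_m (m - d(x, x_m))`, where `ω = (x_0, x_1, …)`. -/
noncomputable def height (G : SimpleGraph X) {o : X} (ω : Boundary G o) (x : X) : ℤ :=
  limUnder atTop (fun m : ℕ => (m : ℤ) - (G.dist x (ω.vertex m) : ℤ))

/-- The averaging operator `𝓔_n^x` with respect to the reference point `x`: the mean of `η` over
`Ω_n(x, ω)` for the measure `ν_x`. -/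
noncomputable def average (G : SimpleGraph X) (q : ℕ) {o : X} (x : X) (n : ℕ)
    (η : Boundary G o → ℂ) (ω : Boundary G o) : ℂ :=
  ⨍ ω' in cylinderAt G x n ω, η ω' ∂(visibilityMeasure G q o x)

/-- `τ = π / log q`. -/
noncomputable def tau (q : ℕ) : ℝ := Real.pi / Real.log q

/-- The function `𝐜(z)` of the homogeneous tree of degree `q + 1`. -/
noncomputable def cFun (q : ℕ) (z : ℂ) : ℂ :=
  (q : ℂ) ^ (1 / 2 : ℂ) / ((q : ℂ) + 1) *
    (((q : ℂ) ^ (1 / 2 + Complex.I * z) - (q : ℂ) ^ (-(1 / 2) - Complex.I * z)) /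
      ((q : ℂ) ^ (Complex.I * z) - (q : ℂ) ^ (-(Complex.I * z))))

/-- The Plancherel measure `dμ(s) = c_P |𝐜(s)|⁻² ds`, restricted to `[0, τ]`. -/
noncomputable def plancherel (q : ℕ) : Measure ℝ :=
  (volume.restrict (Icc 0 (tau q))).withDensity fun s =>
    ENNReal.ofReal (q * Real.log q / (4 * Real.pi * (q + 1)) * (‖cFun q s‖ ^ 2)⁻¹)

/-- The operator `OP(a)`, applied to a function `u` of finite support. Only the values of
`a x y ω s` with `0 ≤ s ≤ τ` matter. -/
noncomputable def OP (G : SimpleGraph X) (q : ℕ) {o : X} (a : X → X → Boundary G o → ℝ → ℂ)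
    (u : X → ℂ) (x : X) : ℂ :=
  ∑' y : X, ∫ ω : Boundary G o, (∫ s : ℝ,
    (q : ℂ) ^ ((1 / 2 + Complex.I * (s : ℂ)) * ((height G ω y - height G ω x : ℤ) : ℂ)) *
      a x y ω s * u y ∂(plancherel q)) ∂(visibilityMeasure G q o x)

/-- The derivative `∂_s^k a` on `[0, τ]` (one-sided at the end points). -/
noncomputable def dS (G : SimpleGraph X) (q : ℕ) {o : X} (k : ℕ)
    (a : X → X → Boundary G o → ℝ → ℂ) (x y : X) (ω : Boundary G o) (s : ℝ) : ℂ :=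
  iteratedDerivWithin k (a x y ω) (Icc 0 (tau q)) s

/-- The class `S(𝔛 × 𝔛)` of double symbols; a function on `𝔛 × 𝔛 × Ω × [0, τ]` is given through an
arbitrary extension to `𝔛 × 𝔛 × Ω × ℝ`. -/
structure IsDoubleSymbol (G : SimpleGraph X) (q : ℕ) {o : X}
    (a : X → X → Boundary G o → ℝ → ℂ) : Prop where
  smooth : ∀ (x y : X) (ω : Boundary G o), ContDiffOn ℝ ((⊤ : ℕ∞) : WithTop ℕ∞) (a x y ω) (Icc 0 (tau q))
  continuous : ∀ (k : ℕ) (x y : X),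
    ContinuousOn (fun p : Boundary G o × ℝ => dS G q k a x y p.1 p.2) (univ ×ˢ Icc 0 (tau q))
  regular : ∀ l : ℕ, ∃ C : ℝ, ∀ (n : ℕ) (x y : X) (ω : Boundary G o), ∀ s ∈ Icc 0 (tau q),
    ‖a x y ω s - average G q x n (fun ω' => a x y ω' s) ω‖ ≤ C / (1 + (n : ℝ)) ^ l
  boundary_zero : ∀ (k : ℕ) (x y : X) (ω : Boundary G o),
    dS G q k a x y ω 0 = 0 ∧ dS G q k a x y ω (tau q) = 0

/-- `‖∂_s^k a‖_∞ ∈ [0, ∞]`, the supremum being over `𝔛 × 𝔛 × Ω × [0, τ]`. -/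
noncomputable def supNormDS (G : SimpleGraph X) (q : ℕ) {o : X} (k : ℕ)
    (a : X → X → Boundary G o → ℝ → ℂ) : ℝ≥0∞ :=
  ⨆ (x : X) (y : X) (ω : Boundary G o) (s ∈ Icc 0 (tau q)), ‖dS G q k a x y ω s‖ₑ

/-- `‖a‖_{Ω,l} = sup_{x,y} sup_n (n + 1) ^ l ‖(a - 𝓔_n^x a)(x, y, ·, ·)‖_∞ ∈ [0, ∞]`. -/
noncomputable def omegaNorm (G : SimpleGraph X) (q : ℕ) {o : X} (l : ℕ)
    (a : X → X → Boundary G o → ℝ → ℂ) : ℝ≥0∞ :=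
  ⨆ (x : X) (y : X) (n : ℕ), ((n : ℝ≥0∞) + 1) ^ l *
    ⨆ (ω : Boundary G o) (s ∈ Icc 0 (tau q)),
      ‖a x y ω s - average G q x n (fun ω' => a x y ω' s) ω‖ₑ

end HomTree

/-!
The operator `OP(a)` has the kernel `K(x, y) = ∫∫ q^{(1/2+is)(h_ω(y)-h_ω(x))} a(x, y, ω, s) dμ(s)
dν_x(ω)`. The proof is the pointwise bound `|K(x, y)| ≤ C M q^{-n/2} (1 + n)^{-3}`, `n = d(x, y)`,
where `M` is the norm of `a` on the right-hand side of the theorem, followed by Schur's test.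

*The kernel bound* (`exists_norm_opKernel_le`). If `[x, ω)` leaves the geodesic from `x` to `y`
after `j` steps, then `h_ω(y) - h_ω(x) = 2j - n`, and this happens with `ν_x`-probability of order
`q^{-j}`. Hence `K(x, y)` is `q^{-n/2}` times a sum over `j ≤ n` of averages of the Fourier
integrals `F_k(ω) = ∫ q^{iks} a(x, y, ω, s) dμ(s)` at `k = 2j - n`. Since `a` vanishes to infinite
order at `0` and `τ` and the Plancherel density is smooth, four integrations by parts give `|F_k|
≲ M (1 + |k|)^{-4}` (`exists_fourier_decay`). This is enough for `j ≤ n/4`, but not for `j` near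
`n/2`, where `k` is small. For `j ≥ m = ⌊n/4⌋ + 1` the symbol is replaced by its average over the
cylinder `Ω(x, x_m)`, `x_m` being the vertex of the geodesic at distance `m` from `x`; the
regularity of `a` in `ω` bounds the error by `M (1 + m)^{-4}`. Now the density of `μ` is `1 -
q^{2is}` times another smooth function, because `|𝐜|^{-2}` has double zeros at `0` and `τ`. So
`F_k = H_k - H_{k+2}` with `H` decaying like `F`, and the sum over `j`, whose weights `q^j ν_x`
are constant for `0 < j < n`, telescopes to terms of frequency at least of order `n`
(`norm_integral_le_of_telescoping`).

*Schur's test* (`exists_clm_of_schur`). For a fixed boundary point `ω` the weight `q^{h_ω/2}`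
satisfies `∑_{d(x,y)=n} q^{h_ω(y)/2} ≤ 2 (n + 1) q^{n/2} q^{h_ω(x)/2}` (`tsum_radial_le`), so the
norm of the operator is at most `2 C M ∑ (1 + n)^{-2}`.
-/

namespace HomTree

/-! ### Geodesics, heights and cylinders in a tree -/

section tree

variable {X : Type*} {G : SimpleGraph X}

/-- Along a half geodesic the distance to a vertex `y` first decreases by one at each step, until
the point `ρ j` where the geodesic from `y` joins the ray, and increases from there on. -/
lemma IsGeodesicRay.exists_turn (hG : G.IsTree) {ρ : ℕ → X} (h : IsGeodesicRay G ρ) (y : X) :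
    ∃ j ≤ G.dist (ρ 0) y, (∀ i ≤ j, G.dist y (ρ i) + i = G.dist (ρ 0) y) ∧
      ∀ k, G.dist y (ρ (j + k)) + j = G.dist (ρ 0) y + k := by
  obtain ⟨m, hm⟩ : ∃ m, ∀ n, G.dist y (ρ m) ≤ G.dist y (ρ n) := by
    have hne : (Set.range fun n => G.dist y (ρ n)).Nonempty := ⟨_, 0, rfl⟩
    obtain ⟨m, hm⟩ := Nat.sInf_mem hne
    exact ⟨m, fun n => hm.le.trans (Nat.sInf_le ⟨n, rfl⟩)⟩
  have hgr := h.grow hG (p := y) (m := m) (by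
    rcases hG.dist_eq_dist_add_one_of_adj y (h.adj m) with e | e
    · have := hm (m + 1); omega
    · exact e)
  have hdec : ∀ i ≤ m, G.dist y (ρ i) + i = G.dist (ρ 0) y := by
    intro i
    induction i with
    | zero => intro _; rw [SimpleGraph.dist_comm]; rfl
    | succ i ih =>
      intro hi
      have ih' := ih (by omega)
      rcases hG.dist_eq_dist_add_one_of_adj y (h.adj i) with e | e
      · omega
      · -- an increase before the minimum would persist up to the minimum
        have := h.grow hG e (m - i)
        rw [show i + (m - i) = m by omega] at this
        have := hm i
        omega
  have := hdec m le_rfl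
  refine ⟨m, by omega, hdec, fun k => ?_⟩
  have := hgr k
  omega

/-- The limit defining the height function is attained at a finite stage. -/
lemma eventually_height (hG : G.IsTree) {o : X} (ω : Boundary G o) (x : X) :
    ∀ᶠ m : ℕ in atTop, (m : ℤ) - G.dist x (ω.vertex m) = height G ω x := by
  obtain ⟨j, -, -, h⟩ := ω.isRay.exists_turn hG x
  have hev : ∀ᶠ m : ℕ in atTop, (m : ℤ) - G.dist x (ω.vertex m) =
      2 * j - G.dist (ω.vertex 0) x := by
    filter_upwards [eventually_ge_atTop j] with m hm
    obtain ⟨k, rfl⟩ := Nat.exists_eq_add_of_le hm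
    have := h k
    push_cast
    omega
  have hlim : height G ω x = 2 * j - G.dist (ω.vertex 0) x := by
    refine Tendsto.limUnder_eq ?_
    exact tendsto_const_nhds.congr' (hev.mono fun m hm => hm.symm)
  rw [hlim]
  exact hev

/-- If the geodesics from `x` to `y` and to `ω` separate at distance `j` from `x`, the height
changes by `2 j - d(x, y)` between `x` and `y`. -/
lemma height_sub_height (hG : G.IsTree) {o x y : X} {ω : Boundary G o} {γ : ℕ → X}
    (hγ : IsRayTo G x ω γ) {j : ℕ}
    (hj : ∀ k, G.dist y (γ (j + k)) + j = G.dist (γ 0) y + k) :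
    height G ω y - height G ω x = 2 * (j : ℤ) - G.dist x y := by
  obtain ⟨h1, h2, k, l, hkl⟩ := hγ
  obtain ⟨N, hN⟩ := eventually_atTop.1 ((eventually_height hG ω x).and (eventually_height hG ω y))
  obtain ⟨hx, hy⟩ := hN (N + j + l) (by omega)
  have e := hkl (N + j)
  have e1 := h1.dist_zero (N + j + k)
  have e2 := hj (N + k)
  rw [show j + (N + k) = N + j + k by ring] at e2
  rw [h2, e] at e1
  rw [e, h2] at e2
  omega

lemma exists_isRayTo (hG : G.IsTree) {o : X} (x : X) (ω : Boundary G o) :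
    ∃ γ, IsRayTo G x ω γ :=
  exists_ray hG ω.isRay x

lemma dist_geodesic_end (hG : G.IsTree) {x y : X} {δ : ℕ → X} (h1 : δ (G.dist x y) = y)
    (h2 : ∀ i < G.dist x y, G.Adj (δ i) (δ (i + 1))) (h3 : ∀ i ≤ G.dist x y, G.dist x (δ i) = i)
    {i : ℕ} (hi : i ≤ G.dist x y) : G.dist (δ i) y + i = G.dist x y := by
  have hup : ∀ k ≤ G.dist x y, G.dist (δ (G.dist x y - k)) y ≤ k := by
    intro k
    induction k with
    | zero => simp [h1]
    | succ k ih =>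
      intro hk
      have := hG.connected.dist_triangle (u := δ (G.dist x y - (k + 1)))
        (v := δ (G.dist x y - k)) (w := y)
      have e := SimpleGraph.dist_eq_one_iff_adj.2 (h2 (G.dist x y - (k + 1)) (by omega))
      rw [show G.dist x y - (k + 1) + 1 = G.dist x y - k by omega] at e
      have := ih (by omega)
      omega
  have a := hup (G.dist x y - i) (by omega)
  rw [show G.dist x y - (G.dist x y - i) = i by omega] at a
  have := hG.connected.dist_triangle (u := x) (v := δ i) (w := y)
  have := h3 i hi
  omega

/-- A vertex between `x` and `y` is determined by its distances to them. -/
lemma eq_of_dist_eq (hG : G.IsTree) {x y v w : X} (hv : G.dist x v + G.dist v y = G.dist x y)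
    (hw : G.dist x w + G.dist w y = G.dist x y) (h : G.dist x v = G.dist x w) : v = w := by
  obtain ⟨P, -, hP⟩ := hG.connected.exists_path_of_dist x v
  obtain ⟨P', -, hP'⟩ := hG.connected.exists_path_of_dist v y
  obtain ⟨Q, -, hQ⟩ := hG.connected.exists_path_of_dist x w
  obtain ⟨Q', -, hQ'⟩ := hG.connected.exists_path_of_dist w y
  have e1 : (P.append P').IsPath := SimpleGraph.Walk.isPath_of_length_eq_dist _
    (by rw [SimpleGraph.Walk.length_append]; omega)
  have e2 : (Q.append Q').IsPath := SimpleGraph.Walk.isPath_of_length_eq_dist _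
    (by rw [SimpleGraph.Walk.length_append]; omega)
  have e3 := (hG.existsUnique_path x y).unique e1 e2
  have e4 := congrArg (fun W => SimpleGraph.Walk.getVert W (G.dist x v)) e3
  simp only [SimpleGraph.Walk.getVert_append] at e4
  rw [if_neg (by omega), if_neg (by omega)] at e4
  simpa [hP, hQ, h] using e4

/-- The geodesic `δ` from `x` to `y` separates from `[x, ω)` at a time `j`: the cylinders
`Ω(x, δ i)` containing `ω` are those with `i ≤ j`, and `j` gives the change of height. -/
lemma exists_turn_segment (hG : G.IsTree) {o x y : X} {δ : ℕ → X} (h1 : δ (G.dist x y) = y)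
    (h2 : ∀ i < G.dist x y, G.Adj (δ i) (δ (i + 1))) (h3 : ∀ i ≤ G.dist x y, G.dist x (δ i) = i)
    (ω : Boundary G o) :
    ∃ j ≤ G.dist x y, (∀ i ≤ G.dist x y, ω ∈ cylinder G x (δ i) ↔ i ≤ j) ∧
      height G ω y - height G ω x = 2 * (j : ℤ) - G.dist x y := by
  obtain ⟨γ, hγ⟩ := exists_isRayTo hG x ω
  have hray := hγ.1
  have h0 := hγ.2.1
  obtain ⟨j, hj, hdec, hinc⟩ := hray.exists_turn hG y
  rw [h0] at hj
  refine ⟨j, hj, fun i hi => ?_, height_sub_height hG hγ hinc⟩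
  have e1 := dist_geodesic_end hG h1 h2 h3 hi
  have e2 := h3 i hi
  have e3 := hray.dist_zero i
  rw [h0] at e3
  rw [mem_cylinder_iff hG hγ, e2]
  constructor
  · intro hi'
    by_contra hlt
    have := hinc (i - j)
    rw [show j + (i - j) = i by omega, hi', SimpleGraph.dist_comm, h0] at this
    omega
  · intro hij
    have := hdec i hij
    rw [h0, SimpleGraph.dist_comm] at this
    exact eq_of_dist_eq hG (x := x) (y := y) (by omega) (by omega) (by omega)

lemma cylinderAt_eq (hG : G.IsTree) {o x v : X} {ω : Boundary G o} (h : ω ∈ cylinder G x v) :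
    cylinderAt G x (G.dist x v) ω = cylinder G x v := by
  obtain ⟨γ, hγ⟩ := exists_isRayTo hG x ω
  have hs : {y : X | G.dist x y = G.dist x v ∧ ω ∈ cylinder G x y} = {v} := by
    ext y
    simp only [Set.mem_ofPred_eq, Set.mem_singleton_iff]
    constructor
    · rintro ⟨hy, hy'⟩
      rw [mem_cylinder_iff hG hγ] at h hy'
      rw [← hy', hy, h]
    · rintro rfl
      exact ⟨rfl, h⟩
  rw [cylinderAt, hs]
  simp

lemma measurableSet_cylinder {o : X} (x y : X) : MeasurableSet (cylinder (o := o) G x y) := by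
  refine IsOpen.measurableSet ?_
  exact TopologicalSpace.isOpen_generateFrom_of_mem ⟨x, y, rfl⟩

/-- The sphere of radius `m` has at most `2 q ^ m` vertices, because the corresponding cylinders
are disjoint and `ν_z` has total mass one. -/
lemma tsum_sphere_le (hG : G.IsTree) [G.LocallyFinite] {q : ℕ} (hq1 : 1 ≤ q)
    (hq : G.IsRegularOfDegree (q + 1)) (z : X) (m : ℕ) :
    ∑' _ : {y : X // G.dist z y = m}, (1 : ℝ≥0∞) ≤ 2 * (q : ℝ≥0∞) ^ m := by
  have hcX := countable_vertices hG z
  rcases m with _ | n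
  · have : Subsingleton {y : X // G.dist z y = 0} := by
      refine ⟨fun a b => Subtype.ext ?_⟩
      rw [← hG.connected.dist_eq_zero_iff.1 a.2, ← hG.connected.dist_eq_zero_iff.1 b.2]
    rw [tsum_eq_single ⟨z, by simp⟩ (fun b hb => absurd (Subsingleton.elim _ _) hb)]
    norm_num
  · obtain ⟨hprob, hν⟩ := isVisibilityMeasure_visibilityMeasure hG hq1 hq z z
    have hdisj : Pairwise (Function.onFun Disjoint
        fun y : {y : X // G.dist z y = n + 1} => cylinder (o := z) G z y.1) := by
      intro a b hab
      refine Set.disjoint_left.2 fun ω ha hb => hab (Subtype.ext ?_)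
      obtain ⟨γ, hγ⟩ := exists_isRayTo hG z ω
      rw [mem_cylinder_iff hG hγ] at ha hb
      rw [← ha, ← hb, a.2, b.2]
    have hle := (measure_iUnion hdisj
      (fun y => measurableSet_cylinder (o := z) (G := G) z y.1)).symm.le.trans
      (prob_le_one (μ := visibilityMeasure G q z z))
    rw [tsum_congr (fun y : {y : X // G.dist z y = n + 1} => hν n y.1 y.2)] at hle
    set c : ℝ≥0∞ := ((q : ℝ≥0∞) + 1) * (q : ℝ≥0∞) ^ n with hc
    have hqne : (q : ℝ≥0∞) ≠ 0 := by
      have : q ≠ 0 := by omega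
      exact_mod_cast this
    have hc0 : c ≠ 0 := mul_ne_zero (by simp) (pow_ne_zero _ hqne)
    have hct : c ≠ ∞ := by finiteness
    have : (∑' _ : {y : X // G.dist z y = n + 1}, (1 : ℝ≥0∞)) * c⁻¹ ≤ 1 := by
      rw [← ENNReal.tsum_mul_right]
      simpa using hle
    calc _ ≤ c := by
          rw [← div_eq_mul_inv] at this
          simpa using (ENNReal.div_le_iff hc0 hct).1 this
      _ ≤ 2 * (q : ℝ≥0∞) ^ (n + 1) := by
          rw [hc, pow_succ', ← mul_assoc]
          gcongr
          rw [two_mul]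
          gcongr
          exact_mod_cast hq1

lemma nonempty_boundary (hG : G.IsTree) [G.LocallyFinite] {q : ℕ} (hq1 : 1 ≤ q)
    (hq : G.IsRegularOfDegree (q + 1)) (o : X) : Nonempty (Boundary G o) := by
  have := (isVisibilityMeasure_visibilityMeasure hG hq1 hq o o).1
  exact nonempty_of_isProbabilityMeasure (visibilityMeasure G q o o)

/-- The function `y ↦ q ^ (h_ω(y) / 2)` is almost an eigenfunction of every radial kernel: going up
`j` steps towards `ω` and down `n - j` steps reaches at most `2 q ^ (n - j)` vertices, whose weight is
`q ^ ((2 j - n) / 2)` times the weight of `x`. -/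
lemma tsum_radial_le (hG : G.IsTree) [G.LocallyFinite] {q : ℕ} (hq1 : 1 ≤ q)
    (hq : G.IsRegularOfDegree (q + 1)) {o : X} (ω : Boundary G o) (φ : ℕ → ℝ≥0∞) (x : X) :
    ∑' y, φ (G.dist x y) * ENNReal.ofReal ((q : ℝ) ^ ((height G ω y : ℝ) / 2)) ≤
      (∑' n : ℕ, 2 * ((n : ℝ≥0∞) + 1) * ENNReal.ofReal ((q : ℝ) ^ ((n : ℝ) / 2)) * φ n) *
        ENNReal.ofReal ((q : ℝ) ^ ((height G ω x : ℝ) / 2)) := by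
  classical
  have hq0 : (0 : ℝ) < q := by exact_mod_cast hq1
  obtain ⟨γ, hγ⟩ := exists_isRayTo hG x ω
  set w : X → ℝ≥0∞ := fun y => ENNReal.ofReal ((q : ℝ) ^ ((height G ω y : ℝ) / 2)) with hw
  let t : ℕ → ℕ → ℝ≥0∞ := fun n j => φ n * (ENNReal.ofReal ((q : ℝ) ^ ((2 * j - n : ℝ) / 2)) * w x)
  have hpt : ∀ y, φ (G.dist x y) * w y ≤ ∑' n : ℕ, ∑ j ∈ Finset.range (n + 1),
      if G.dist (γ j) y = n - j then t n j else 0 := by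
    intro y
    obtain ⟨j, hj, hdec, hinc⟩ := hγ.1.exists_turn hG y
    rw [hγ.2.1] at hj hdec
    have hh := height_sub_height hG hγ hinc
    refine le_trans ?_ (ENNReal.le_tsum (G.dist x y))
    refine le_trans ?_ (Finset.single_le_sum (f := fun j =>
      if G.dist (γ j) y = G.dist x y - j then t (G.dist x y) j else 0)
      (fun _ _ => zero_le) (Finset.mem_range.2 (Nat.lt_succ_of_le hj)))
    have := hdec j le_rfl
    rw [SimpleGraph.dist_comm] at this
    rw [if_pos (by omega)]
    have hR : (height G ω y : ℝ) = (2 * j - G.dist x y : ℝ) + height G ω x := by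
      have : height G ω y = 2 * (j : ℤ) - G.dist x y + height G ω x := by omega
      exact_mod_cast this
    simp only [t, hw]
    rw [← ENNReal.ofReal_mul (by positivity), ← Real.rpow_add hq0, ← add_div, hR]
  calc ∑' y, φ (G.dist x y) * w y
      ≤ ∑' y, ∑' n : ℕ, ∑ j ∈ Finset.range (n + 1),
          if G.dist (γ j) y = n - j then t n j else 0 := ENNReal.tsum_le_tsum hpt
    _ = ∑' n : ℕ, ∑ j ∈ Finset.range (n + 1), ∑' y,
          if G.dist (γ j) y = n - j then t n j else 0 := by
        rw [ENNReal.tsum_comm]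
        refine tsum_congr fun n => ?_
        exact Summable.tsum_finsetSum fun _ _ => ENNReal.summable
    _ ≤ ∑' n : ℕ, ∑ j ∈ Finset.range (n + 1),
          2 * ENNReal.ofReal ((q : ℝ) ^ ((n : ℝ) / 2)) * φ n * w x := by
        refine ENNReal.tsum_le_tsum fun n => Finset.sum_le_sum fun j hj => ?_
        have hjn : j ≤ n := Nat.lt_succ_iff.1 (Finset.mem_range.1 hj)
        have e1 : (∑' y, if G.dist (γ j) y = n - j then t n j else 0) =
            (∑' _ : {y : X // G.dist (γ j) y = n - j}, (1 : ℝ≥0∞)) * t n j := by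
          rw [← ENNReal.tsum_mul_right]
          simp only [one_mul]
          refine Eq.trans (tsum_congr fun y => ?_)
            (tsum_subtype {y : X | G.dist (γ j) y = n - j} fun _ => t n j).symm
          simp only [Set.indicator_apply, Set.mem_ofPred_eq]
        rw [e1]
        refine (mul_le_mul_left (tsum_sphere_le hG hq1 hq (γ j) (n - j)) _).trans (le_of_eq ?_)
        have e2 : (q : ℝ≥0∞) ^ (n - j) * ENNReal.ofReal ((q : ℝ) ^ ((2 * j - n : ℝ) / 2)) =
            ENNReal.ofReal ((q : ℝ) ^ ((n : ℝ) / 2)) := by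
          rw [show (q : ℝ≥0∞) = ENNReal.ofReal q by simp, ← ENNReal.ofReal_pow hq0.le,
            ← ENNReal.ofReal_mul (by positivity), ← Real.rpow_natCast, ← Real.rpow_add hq0]
          congr 2
          push_cast [hjn]
          ring
        rw [← e2]
        simp only [t]
        ring
    _ = _ := by
        rw [← ENNReal.tsum_mul_right]
        refine tsum_congr fun n => ?_
        rw [Finset.sum_const, Finset.card_range, nsmul_eq_mul]
        push_cast
        ring

end tree

/-! ### Fourier integrals of amplitudes vanishing at the end points -/

section oscillatory

/-- One integration by parts, for an amplitude that vanishes at the end points. -/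
lemma abs_mul_norm_integral_exp_mul {T : ℝ} (hT : 0 < T) {g g' : ℝ → ℂ}
    (hg : ∀ s ∈ Icc 0 T, HasDerivWithinAt g (g' s) (Icc 0 T) s) (hg' : ContinuousOn g' (Icc 0 T))
    (h0 : g 0 = 0) (h1 : g T = 0) (l : ℝ) :
    |l| * ‖∫ s in (0 : ℝ)..T, Complex.exp (Complex.I * (l * s)) * g s‖ =
      ‖∫ s in (0 : ℝ)..T, Complex.exp (Complex.I * (l * s)) * g' s‖ := by
  have hE : ∀ s : ℝ, HasDerivAt (fun s : ℝ => Complex.exp (Complex.I * (l * s)))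
      (Complex.exp (Complex.I * (l * s)) * (Complex.I * l)) s := by
    intro s
    have h : HasDerivAt (fun s : ℝ => Complex.I * ((l : ℂ) * (s : ℂ))) (Complex.I * l) s := by
      have := ((Complex.ofRealCLM.hasDerivAt (x := s)).const_mul (l : ℂ)).const_mul Complex.I
      simpa using this
    exact h.cexp
  have hI := intervalIntegral.integral_mul_deriv_eq_deriv_mul_of_hasDerivWithinAt
    (a := 0) (b := T) (u := fun s : ℝ => Complex.exp (Complex.I * (l * s))) (v := g)
    (u' := fun s : ℝ => Complex.exp (Complex.I * (l * s)) * (Complex.I * l)) (v' := g')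
    (fun s _ => (hE s).hasDerivWithinAt)
    (by rw [uIcc_of_le hT.le]; exact hg)
    (Continuous.intervalIntegrable (by fun_prop) _ _)
    (ContinuousOn.intervalIntegrable (by rwa [uIcc_of_le hT.le]))
  rw [hI, h0, h1]
  have : ∀ s : ℝ, Complex.exp (Complex.I * (l * s)) * (Complex.I * l) * g s =
      (Complex.I * l) * (Complex.exp (Complex.I * (l * s)) * g s) := fun s => by ring
  simp only [this, intervalIntegral.integral_const_mul]
  simp

lemma norm_integral_exp_mul_le_sup {T : ℝ} (hT : 0 < T) {g : ℝ → ℂ} {B : ℝ}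
    (hB : ∀ s ∈ Icc 0 T, ‖g s‖ ≤ B) (l : ℝ) :
    ‖∫ s in (0 : ℝ)..T, Complex.exp (Complex.I * (l * s)) * g s‖ ≤ B * T := by
  have := intervalIntegral.norm_integral_le_of_norm_le_const (a := (0 : ℝ)) (b := T) (C := B)
    (f := fun s : ℝ => Complex.exp (Complex.I * (l * s)) * g s) (by
      intro s hs
      rw [uIoc_of_le hT.le] at hs
      have e : ‖Complex.exp (Complex.I * (l * s))‖ = 1 := by
        rw [mul_comm, ← Complex.ofReal_mul]
        exact Complex.norm_exp_ofReal_mul_I _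
      rw [norm_mul, e, one_mul]
      exact hB s (Ioc_subset_Icc_self hs))
  simpa [abs_of_pos hT] using this

/-- An amplitude all of whose derivatives vanish at the end points can be integrated by parts
without boundary terms. -/
lemma abs_pow_mul_norm_integral_exp_mul {T : ℝ} (hT : 0 < T) {g : ℝ → ℂ} {N : ℕ}
    (hg : ContDiffOn ℝ N g (Icc 0 T))
    (h0 : ∀ k < N, iteratedDerivWithin k g (Icc 0 T) 0 = 0)
    (h1 : ∀ k < N, iteratedDerivWithin k g (Icc 0 T) T = 0) (l : ℝ) {k : ℕ} (hk : k ≤ N) :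
    |l| ^ k * ‖∫ s in (0 : ℝ)..T, Complex.exp (Complex.I * (l * s)) * g s‖ =
      ‖∫ s in (0 : ℝ)..T, Complex.exp (Complex.I * (l * s)) *
        iteratedDerivWithin k g (Icc 0 T) s‖ := by
  have hU := uniqueDiffOn_Icc hT
  induction k with
  | zero => simp
  | succ k ih =>
    have hkN : k < N := hk
    rw [pow_succ', mul_assoc, ih hkN.le]
    refine abs_mul_norm_integral_exp_mul hT (fun s hs => ?_)
      (hg.continuousOn_iteratedDerivWithin (by exact_mod_cast hk) hU) (h0 k hkN) (h1 k hkN) l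
    have hd := hg.differentiableOn_iteratedDerivWithin (m := k) (by exact_mod_cast hkN) hU s hs
    rw [iteratedDerivWithin_succ]
    exact hd.hasDerivWithinAt

/-- Leibniz bound for the iterated derivatives of a product. -/
lemma norm_iteratedDerivWithin_mul_le {T : ℝ} (hT : 0 < T) {N : ℕ} {f g : ℝ → ℂ}
    (hf : ContDiffOn ℝ N f (Icc 0 T)) (hg : ContDiffOn ℝ N g (Icc 0 T)) {k : ℕ} (hk : k ≤ N)
    {s : ℝ} (hs : s ∈ Icc 0 T) :
    ‖iteratedDerivWithin k (fun t => f t * g t) (Icc 0 T) s‖ ≤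
      ∑ i ∈ Finset.range (k + 1), (k.choose i : ℝ) * ‖iteratedDerivWithin i f (Icc 0 T) s‖ *
        ‖iteratedDerivWithin (k - i) g (Icc 0 T) s‖ := by
  simpa only [norm_iteratedFDerivWithin_eq_norm_iteratedDerivWithin] using
    norm_iteratedFDerivWithin_mul_le (𝕜 := ℝ) hf hg (uniqueDiffOn_Icc hT) hs
      (n := k) (by exact_mod_cast hk)

/-- Decay of the Fourier integrals `∫ e^{ils} b(s) w(s) ds` for a fixed smooth weight `w`,
uniformly in the smooth amplitude `b` that vanishes to all orders at the end points. -/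
lemma exists_fourier_decay {T L : ℝ} (hT : 0 < T) (hL : 0 < L) {w : ℝ → ℂ} (hw : ContDiff ℝ 4 w) :
    ∃ C : ℝ, 0 < C ∧ ∀ (b : ℝ → ℂ) (B : ℝ), ContDiffOn ℝ 4 b (Icc 0 T) →
      (∀ k < 4, iteratedDerivWithin k b (Icc 0 T) 0 = 0 ∧
        iteratedDerivWithin k b (Icc 0 T) T = 0) →
      (∀ k ≤ 4, ∀ s ∈ Icc 0 T, ‖iteratedDerivWithin k b (Icc 0 T) s‖ ≤ B) →
      ∀ k : ℤ, ‖∫ s in (0 : ℝ)..T, Complex.exp (Complex.I * (((k * L : ℝ) : ℂ) * s)) *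
        (b s * w s)‖ ≤ C * B / (1 + |(k : ℝ)|) ^ 4 := by
  have hU := uniqueDiffOn_Icc hT
  have hwc : ∀ k ≤ 4, ContinuousOn (iteratedDerivWithin k w (Icc 0 T)) (Icc 0 T) := fun k hk =>
    hw.contDiffOn.continuousOn_iteratedDerivWithin (by exact_mod_cast hk) hU
  have hbd : ∀ k : ℕ, ∃ D : ℝ, k ≤ 4 → ∀ s ∈ Icc 0 T, ‖iteratedDerivWithin k w (Icc 0 T) s‖ ≤ D := by
    intro k
    by_cases hk : k ≤ 4
    · obtain ⟨D, hD⟩ := isCompact_Icc.exists_bound_of_continuousOn (hwc k hk)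
      exact ⟨D, fun _ => hD⟩
    · exact ⟨0, fun h => absurd h hk⟩
  choose D hD using hbd
  set E : ℝ := ∑ k ∈ Finset.range 5, |D k| with hE
  have hDE : ∀ k ≤ 4, ∀ s ∈ Icc 0 T, ‖iteratedDerivWithin k w (Icc 0 T) s‖ ≤ E := by
    intro k hk s hs
    refine (hD k hk s hs).trans ((le_abs_self _).trans ?_)
    exact Finset.single_le_sum (f := fun k => |D k|) (fun _ _ => abs_nonneg _)
      (Finset.mem_range.2 (Nat.lt_succ_of_le hk))
  have hE0 : 0 ≤ E := Finset.sum_nonneg fun _ _ => abs_nonneg _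
  refine ⟨16 * (1 + (L ^ 4)⁻¹) * (16 * (E + 1) * T), by positivity, ?_⟩
  intro b B hb hb0 hbB k
  have hB0 : 0 ≤ B := (norm_nonneg _).trans (hbB 0 (by norm_num) 0 ⟨le_rfl, hT.le⟩)
  have hprod : ∀ k ≤ 4, ∀ s ∈ Icc 0 T,
      ‖iteratedDerivWithin k (fun t => b t * w t) (Icc 0 T) s‖ ≤ 16 * (E + 1) * B := by
    intro k hk s hs
    refine (norm_iteratedDerivWithin_mul_le hT hb hw.contDiffOn hk hs).trans ?_
    calc _ ≤ ∑ i ∈ Finset.range (k + 1), (k.choose i : ℝ) * (B * E) := by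
          refine Finset.sum_le_sum fun i hi => ?_
          have hi' := Finset.mem_range.1 hi
          rw [mul_assoc]
          gcongr
          · exact hbB i (by omega) s hs
          · exact hDE (k - i) (by omega) s hs
      _ = 2 ^ k * (B * E) := by
          rw [← Finset.sum_mul]
          congr 1
          exact_mod_cast Nat.sum_range_choose k
      _ ≤ 2 ^ 4 * (B * (E + 1)) := by
          gcongr
          · norm_num
          · linarith
      _ = _ := by ring
  have hvan : ∀ p ∈ Icc 0 T, (∀ k < 4, iteratedDerivWithin k b (Icc 0 T) p = 0) →
      ∀ k < 4, iteratedDerivWithin k (fun t => b t * w t) (Icc 0 T) p = 0 := by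
    intro p hp h k hk
    have := norm_iteratedDerivWithin_mul_le hT hb hw.contDiffOn hk.le hp
    rw [Finset.sum_eq_zero] at this
    · exact norm_le_zero_iff.1 this
    · intro i hi
      have hi' := Finset.mem_range.1 hi
      rw [h i (by omega)]
      simp
  have hprodC : ContDiffOn ℝ (4 : ℕ) (fun t => b t * w t) (Icc 0 T) := hb.mul hw.contDiffOn
  set J := ‖∫ s in (0 : ℝ)..T, Complex.exp (Complex.I * (((k * L : ℝ) : ℂ) * s)) * (b s * w s)‖
    with hJ
  have hJ0 : J ≤ 16 * (E + 1) * B * T := norm_integral_exp_mul_le_sup hT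
    (fun s hs => by simpa using hprod 0 (by norm_num) s hs) _
  have hJ4 : |(k * L : ℝ)| ^ 4 * J ≤ 16 * (E + 1) * B * T := by
    rw [hJ, abs_pow_mul_norm_integral_exp_mul hT hprodC
      (hvan 0 ⟨le_rfl, hT.le⟩ fun k hk => (hb0 k hk).1)
      (hvan T ⟨hT.le, le_rfl⟩ fun k hk => (hb0 k hk).2) _ le_rfl]
    exact norm_integral_exp_mul_le_sup hT (hprod 4 le_rfl) _
  rw [abs_mul, abs_of_pos hL, mul_pow] at hJ4
  have hk4 : |(k : ℝ)| ^ 4 * J ≤ (L ^ 4)⁻¹ * (16 * (E + 1) * B * T) := by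
    rw [← div_eq_inv_mul, le_div_iff₀ (by positivity)]
    linarith
  rw [le_div_iff₀ (by positivity)]
  have hJn : 0 ≤ J := norm_nonneg _
  have hpow : (1 + |(k : ℝ)|) ^ 4 ≤ 16 * (1 + |(k : ℝ)| ^ 4) := by
    have := add_pow_le (zero_le_one (α := ℝ)) (abs_nonneg (k : ℝ)) 4
    norm_num at this
    nlinarith [pow_nonneg (abs_nonneg (k : ℝ)) 4]
  calc J * (1 + |(k : ℝ)|) ^ 4 ≤ J * (16 * (1 + |(k : ℝ)| ^ 4)) := by gcongr
    _ = 16 * (J + |(k : ℝ)| ^ 4 * J) := by ring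
    _ ≤ 16 * (16 * (E + 1) * B * T + (L ^ 4)⁻¹ * (16 * (E + 1) * B * T)) := by gcongr
    _ = _ := by ring

end oscillatory

/-! ### Schur's test on `ℓ²` -/

section schur

variable {X : Type*}

lemma tsum_mul_sq_le_tsum_sq_mul (f g : X → ℝ≥0∞) :
    (∑' y, f y * g y) ^ 2 ≤ (∑' y, f y ^ 2) * ∑' y, g y ^ 2 := by
  have h : ∑' y, f y * g y ≤ (∑' y, f y ^ 2) ^ (1 / 2 : ℝ) * (∑' y, g y ^ 2) ^ (1 / 2 : ℝ) := by
    rw [ENNReal.tsum_eq_iSup_sum]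
    refine iSup_le fun s => ?_
    have := ENNReal.inner_le_Lp_mul_Lq s f g Real.HolderConjugate.two_two
    simp only [ENNReal.rpow_two] at this
    refine this.trans ?_
    gcongr <;> exact ENNReal.sum_le_tsum s
  calc _ ≤ ((∑' y, f y ^ 2) ^ (1 / 2 : ℝ) * (∑' y, g y ^ 2) ^ (1 / 2 : ℝ)) ^ 2 := by gcongr
    _ = _ := by
      rw [mul_pow, ← ENNReal.rpow_two, ← ENNReal.rpow_two, ← ENNReal.rpow_mul, ← ENNReal.rpow_mul]
      norm_num

/-- The Schur test with a positive weight, for non-negative kernels. -/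
lemma schur_test_sq {k : X → X → ℝ≥0∞} {w : X → ℝ≥0∞} (hw0 : ∀ x, w x ≠ 0) (hwt : ∀ x, w x ≠ ∞)
    {A : ℝ≥0∞} (h1 : ∀ x, ∑' y, k x y * w y ≤ A * w x) (h2 : ∀ y, ∑' x, k x y * w x ≤ A * w y)
    (f : X → ℝ≥0∞) : ∑' x, (∑' y, k x y * f y) ^ 2 ≤ A ^ 2 * ∑' y, f y ^ 2 := by
  have hsq : ∀ c : ℝ≥0∞, (c ^ (1 / 2 : ℝ)) ^ 2 = c := fun c => by
    rw [← ENNReal.rpow_two, ← ENNReal.rpow_mul]; norm_num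
  -- Cauchy-Schwarz for the factors `(k w) ^ (1/2)` and `(k f ^ 2 / w) ^ (1/2)` of `k f`
  have hpt : ∀ x, (∑' y, k x y * f y) ^ 2 ≤ A * w x * ∑' y, k x y * (f y ^ 2 * (w y)⁻¹) := by
    intro x
    have := tsum_mul_sq_le_tsum_sq_mul (fun y => (k x y * w y) ^ (1 / 2 : ℝ))
      (fun y => (k x y * (f y ^ 2 * (w y)⁻¹)) ^ (1 / 2 : ℝ))
    simp only [hsq] at this
    refine le_trans (le_of_eq ?_) (this.trans (by gcongr; exact h1 x))
    congr 1
    refine tsum_congr fun y => ?_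
    rw [← ENNReal.mul_rpow_of_nonneg _ _ (by norm_num)]
    have : k x y * w y * (k x y * (f y ^ 2 * (w y)⁻¹)) = (k x y * f y) ^ 2 := by
      calc _ = (k x y * f y) ^ 2 * (w y * (w y)⁻¹) := by ring
        _ = _ := by rw [ENNReal.mul_inv_cancel (hw0 y) (hwt y), mul_one]
    rw [this, ← ENNReal.rpow_two, ← ENNReal.rpow_mul]
    norm_num
  calc _ ≤ ∑' x, A * w x * ∑' y, k x y * (f y ^ 2 * (w y)⁻¹) := ENNReal.tsum_le_tsum hpt
    _ = ∑' y, A * (f y ^ 2 * (w y)⁻¹) * ∑' x, k x y * w x := by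
      simp only [← ENNReal.tsum_mul_left]
      rw [ENNReal.tsum_comm]
      exact tsum_congr fun y => tsum_congr fun x => by ring
    _ ≤ ∑' y, A * (f y ^ 2 * (w y)⁻¹) * (A * w y) := by
      refine ENNReal.tsum_le_tsum fun y => ?_
      gcongr
      exact h2 y
    _ = _ := by
      rw [← ENNReal.tsum_mul_left]
      refine tsum_congr fun y => ?_
      calc _ = A ^ 2 * f y ^ 2 * (w y * (w y)⁻¹) := by ring
        _ = _ := by rw [ENNReal.mul_inv_cancel (hw0 y) (hwt y), mul_one]

lemma enorm_sq_eq_tsum (u : lp (fun _ : X => ℂ) 2) : ‖u‖ₑ ^ 2 = ∑' y, ‖u y‖ₑ ^ 2 := by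
  have h2 : (0 : ℝ) < (2 : ℝ≥0∞).toReal := by norm_num
  have h := lp.norm_rpow_eq_tsum h2 u
  have hs := lp.memℓp u |>.summable h2
  norm_num at h hs
  rw [← ofReal_norm, ← ENNReal.ofReal_pow (norm_nonneg _), h,
    ENNReal.ofReal_tsum_of_nonneg (fun _ => by positivity) hs]
  refine tsum_congr fun y => ?_
  rw [← ofReal_norm, ENNReal.ofReal_pow (norm_nonneg _)]

lemma memlp_two_of_tsum_lt_top {f : X → ℂ} (h : ∑' y, ‖f y‖ₑ ^ 2 ≠ ∞) :
    Memℓp (E := fun _ : X => ℂ) f 2 := by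
  refine memℓp_gen ?_
  have := ENNReal.summable_toReal h
  refine this.congr fun y => ?_
  simp

/-- A kernel that satisfies the Schur test is the kernel of a bounded operator on `ℓ²`. -/
lemma exists_clm_of_schur {K : X → X → ℂ} {w : X → ℝ≥0∞} (hw0 : ∀ x, w x ≠ 0)
    (hwt : ∀ x, w x ≠ ∞) {A : ℝ≥0∞} (hA : A ≠ ∞) (h1 : ∀ x, ∑' y, ‖K x y‖ₑ * w y ≤ A * w x)
    (h2 : ∀ y, ∑' x, ‖K x y‖ₑ * w x ≤ A * w y) :
    ∃ T : lp (fun _ : X => ℂ) 2 →L[ℂ] lp (fun _ : X => ℂ) 2,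
      (∀ u x, T u x = ∑' y, K x y * u y) ∧ ‖T‖ₑ ≤ A := by
  have hS : ∀ u : lp (fun _ : X => ℂ) 2,
      ∑' x, (∑' y, ‖K x y‖ₑ * ‖u y‖ₑ) ^ 2 ≤ A ^ 2 * ‖u‖ₑ ^ 2 := by
    intro u
    rw [enorm_sq_eq_tsum]
    exact schur_test_sq hw0 hwt h1 h2 _
  have hfin : ∀ u : lp (fun _ : X => ℂ) 2, A ^ 2 * ‖u‖ₑ ^ 2 ≠ ∞ := fun u => by finiteness
  have hsum : ∀ (u : lp (fun _ : X => ℂ) 2) x, Summable fun y => K x y * u y := by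
    intro u x
    have hx : (∑' y, ‖K x y‖ₑ * ‖u y‖ₑ) ^ 2 ≠ ∞ :=
      ne_top_of_le_ne_top (hfin u) ((ENNReal.le_tsum x).trans (hS u))
    have hx' : ∑' y, ‖K x y * u y‖ₑ ≠ ∞ := by
      simp only [enorm_mul]
      exact fun h => hx (by rw [h]; simp)
    refine Summable.of_norm ((ENNReal.summable_toReal hx').congr fun y => ?_)
    simp
  have hle : ∀ u : lp (fun _ : X => ℂ) 2,
      ∑' x, ‖∑' y, K x y * u y‖ₑ ^ 2 ≤ A ^ 2 * ‖u‖ₑ ^ 2 := by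
    intro u
    refine le_trans (ENNReal.tsum_le_tsum fun x => ?_) (hS u)
    gcongr
    refine enorm_tsum_le_tsum_enorm.trans (le_of_eq ?_)
    simp only [enorm_mul]
  let T₀ : lp (fun _ : X => ℂ) 2 →ₗ[ℂ] lp (fun _ : X => ℂ) 2 :=
    { toFun := fun u => ⟨fun x => ∑' y, K x y * u y,
        memlp_two_of_tsum_lt_top (ne_top_of_le_ne_top (hfin u) (hle u))⟩
      map_add' := fun u v => by
        ext x
        change ∑' y, K x y * (u y + v y) = ∑' y, K x y * u y + ∑' y, K x y * v y
        rw [← (hsum u x).tsum_add (hsum v x)]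
        exact tsum_congr fun y => mul_add _ _ _
      map_smul' := fun c u => by
        ext x
        change ∑' y, K x y * (c * u y) = c * ∑' y, K x y * u y
        rw [← tsum_mul_left]
        exact tsum_congr fun y => by ring }
  have hT₀ : ∀ u, ‖T₀ u‖ ≤ A.toReal * ‖u‖ := by
    intro u
    have h : ‖T₀ u‖ₑ ^ 2 ≤ (A * ‖u‖ₑ) ^ 2 := by
      rw [enorm_sq_eq_tsum, mul_pow]
      exact hle u
    have h' : ‖T₀ u‖ₑ ≤ A * ‖u‖ₑ := (ENNReal.pow_right_strictMono (n := 2) (by norm_num)).le_iff_le.1 h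
    have h3 := ENNReal.toReal_mono (by finiteness) h'
    simpa using h3
  refine ⟨T₀.mkContinuous A.toReal hT₀, fun u x => rfl, ?_⟩
  rw [← ofReal_norm]
  refine (ENNReal.ofReal_le_ofReal
    (LinearMap.mkContinuous_norm_le T₀ ENNReal.toReal_nonneg hT₀)).trans ?_
  rw [ENNReal.ofReal_toReal hA]

end schur

/-! ### Cancellation along a geodesic -/

section cancellation

/-- Cancellation along a decreasing sequence of sets `C 0 ⊇ … ⊇ C n` with the masses of the
cylinders around the vertices of a geodesic; `J ω` is the last index with `ω ∈ C (J ω)`.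
Frequencies `2 j - n` with `j ≤ n / 4` are large. For the other ones `F` is replaced by its average
over `C m`, `m = n / 4 + 1`, and since `F k = G k - G (k + 2)` the sum over `j` then
telescopes to frequencies of order `n`. -/
lemma norm_integral_le_of_telescoping {Ω : Type*} [MeasurableSpace Ω] (ν : Measure Ω)
    [IsProbabilityMeasure ν] {q n : ℕ} (hq : 1 ≤ q) {C : ℕ → Set Ω}
    (hCm : ∀ i, MeasurableSet (C i)) {J : Ω → ℕ} (hJn : ∀ ω, J ω ≤ n)
    (hJ : ∀ ω, ∀ i ≤ n, ω ∈ C i ↔ i ≤ J ω)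
    (hν : ∀ i < n, ν.real (C (i + 1)) = (((q : ℝ) + 1) * (q : ℝ) ^ i)⁻¹)
    {F H : ℤ → Ω → ℂ} (hF : ∀ k, Integrable (F k) ν) (hH : ∀ k, Integrable (H k) ν)
    (hFH : ∀ k ω, F k ω = H k ω - H (k + 2) ω) {B : ℝ}
    (hFB : ∀ k ω, ‖F k ω‖ ≤ B / (1 + |(k : ℝ)|) ^ 4)
    (hHB : ∀ k ω, ‖H k ω‖ ≤ B / (1 + |(k : ℝ)|) ^ 4)
    (hav : ∀ m ≤ n, ∀ k, ∀ ω ∈ C m, ‖F k ω - ⨍ ω' in C m, F k ω' ∂ν‖ ≤ B / (1 + (m : ℝ)) ^ 4) :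
    ‖∫ ω, (((q : ℝ) ^ J ω : ℝ) : ℂ) * F (2 * (J ω : ℤ) - n) ω ∂ν‖ ≤
      16384 * B / (1 + (n : ℝ)) ^ 3 := by
  have hqR : (1 : ℝ) ≤ q := by exact_mod_cast hq
  have hB0 : 0 ≤ B := by
    obtain ⟨ω⟩ := nonempty_of_isProbabilityMeasure ν
    have := (norm_nonneg _).trans (hFB 0 ω)
    simpa using this
  set β : ℝ := 4096 / (1 + (n : ℝ)) ^ 4 with hβ
  -- `8` bounds the ratio of `n` to all frequencies and radii that occur, and `4096 = 8 ^ 4`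
  have hdecay : ∀ t : ℝ, 0 ≤ t → 1 + (n : ℝ) ≤ 8 * (1 + t) → B / (1 + t) ^ 4 ≤ B * β := by
    intro t ht h
    rw [hβ, div_eq_mul_inv]
    gcongr
    rw [inv_eq_one_div, div_le_div_iff₀ (by positivity) (by positivity)]
    calc 1 * (1 + (n : ℝ)) ^ 4 ≤ (8 * (1 + t)) ^ 4 := by rw [one_mul]; gcongr
      _ = _ := by ring
  set m : ℕ := n / 4 + 1 with hm
  have hmn : 1 + (n : ℝ) ≤ 8 * (1 + (m : ℝ)) := by
    have : 1 + n ≤ 8 * (1 + m) := by omega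
    exact_mod_cast this
  set L : ℕ → Set Ω := fun j => {ω | J ω = j} with hL
  have hLlt : ∀ j < n, L j = C j \ C (j + 1) := by
    intro j hj
    ext ω
    simp only [hL, Set.mem_ofPred_eq, Set.mem_sdiff, hJ ω j hj.le, hJ ω (j + 1) hj]
    omega
  have hLn : L n = C n := by
    ext ω
    have := hJn ω
    simp only [hL, Set.mem_ofPred_eq, hJ ω n le_rfl]
    omega
  have hLm : ∀ j ≤ n, MeasurableSet (L j) := by
    intro j hj
    rcases hj.lt_or_eq with h | rfl
    · rw [hLlt j h]; exact (hCm j).diff (hCm _)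
    · rw [hLn]; exact hCm _
  -- the weights `q ^ j * ν (L j)` do not depend on `j` for `0 < j < n`
  have hmassn : ∀ i, i + 1 = n → (q : ℝ) ^ (i + 1) * ν.real (L (i + 1)) = q / (q + 1) := by
    intro i hi
    rw [hi, hLn, ← hi, hν i (by omega)]
    field_simp
    ring
  have hmass : ∀ i, i + 1 < n →
      (q : ℝ) ^ (i + 1) * ν.real (L (i + 1)) = (q - 1) / (q + 1) := by
    intro i hi
    have hsub : C (i + 1 + 1) ⊆ C (i + 1) := fun ω hω =>
      (hJ ω _ hi.le).2 (le_trans (Nat.le_succ _) ((hJ ω _ hi).1 hω))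
    rw [hLlt _ hi, measureReal_sdiff hsub (hCm _), hν i (by omega), hν (i + 1) (by omega)]
    field_simp
    ring
  have hmass1 : ∀ j ≤ n, (q : ℝ) ^ j * ν.real (L j) ≤ 1 := by
    intro j hj
    rcases j with _ | i
    · simp only [pow_zero, one_mul]; exact measureReal_le_one
    · rcases hj.lt_or_eq with h | h
      · rw [hmass i h, div_le_one (by positivity)]; linarith
      · rw [hmassn i h, div_le_one (by positivity)]; linarith
  have hint : ∀ (k : ℤ) (j : ℕ), IntegrableOn (F k) (L j) ν := fun k j => (hF k).integrableOn
  have hsplit : ∫ ω, (((q : ℝ) ^ J ω : ℝ) : ℂ) * F (2 * (J ω : ℤ) - n) ω ∂ν =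
      ∑ j ∈ Finset.range (n + 1), (((q : ℝ) ^ j : ℝ) : ℂ) * ∫ ω in L j, F (2 * (j : ℤ) - n) ω ∂ν := by
    have hpt : ∀ ω, (((q : ℝ) ^ J ω : ℝ) : ℂ) * F (2 * (J ω : ℤ) - n) ω =
        ∑ j ∈ Finset.range (n + 1), (L j).indicator
          (fun ω => (((q : ℝ) ^ j : ℝ) : ℂ) * F (2 * (j : ℤ) - n) ω) ω := by
      intro ω
      rw [Finset.sum_eq_single_of_mem (J ω) (Finset.mem_range.2 (Nat.lt_succ_of_le (hJn ω)))]
      · rw [Set.indicator_of_mem (show ω ∈ L (J ω) from rfl)]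
      · intro j _ hj
        exact Set.indicator_of_notMem (s := L j) (fun h : J ω = j => hj h.symm) _
    simp only [hpt]
    rw [integral_finsetSum]
    · refine Finset.sum_congr rfl fun j hj => ?_
      have hj' : j ≤ n := Nat.lt_succ_iff.1 (Finset.mem_range.1 hj)
      rw [integral_indicator (hLm j hj'), integral_const_mul]
    · intro j hj
      have hj' : j ≤ n := Nat.lt_succ_iff.1 (Finset.mem_range.1 hj)
      exact ((hF _).const_mul _).indicator (hLm j hj')
  let A : ℤ → ℂ := fun k => ⨍ ω' in C m, F k ω' ∂ν
  let P : ℕ → ℂ := fun j => if m ≤ j then ((((q : ℝ) ^ j * ν.real (L j) : ℝ)) : ℂ) * A (2 * j - n) else 0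
  -- `P j` is the averaged contribution of `L j`; discarding it for `j < m` and averaging it for
  -- `m ≤ j` costs at most `B * β` per step
  have herr : ∀ j ∈ Finset.range (n + 1),
      ‖(((q : ℝ) ^ j : ℝ) : ℂ) * (∫ ω in L j, F (2 * (j : ℤ) - n) ω ∂ν) - P j‖ ≤ B * β := by
    intro j hj
    have hj' : j ≤ n := Nat.lt_succ_iff.1 (Finset.mem_range.1 hj)
    have hgen : ∀ {b c : ℝ}, 0 ≤ c → b ≤ (q : ℝ) ^ j * (c * ν.real (L j)) → b ≤ c := by
      intro b c hc hb
      calc b ≤ c * ((q : ℝ) ^ j * ν.real (L j)) := by linarith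
        _ ≤ c * 1 := by gcongr; exact hmass1 j hj'
        _ = c := mul_one c
    by_cases hmj : m ≤ j
    · have e : (((q : ℝ) ^ j : ℝ) : ℂ) * (∫ ω in L j, F (2 * (j : ℤ) - n) ω ∂ν) - P j =
          (((q : ℝ) ^ j : ℝ) : ℂ) * ∫ ω in L j, (F (2 * (j : ℤ) - n) ω - A (2 * j - n)) ∂ν := by
        simp only [P, if_pos hmj]
        rw [integral_sub (hint _ _) (integrable_const _), setIntegral_const, Complex.real_smul]
        push_cast
        ring
      rw [e, norm_mul, Complex.norm_real, Real.norm_of_nonneg (by positivity)]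
      refine le_trans (hgen (c := B / (1 + (m : ℝ)) ^ 4) (by positivity) ?_)
        (hdecay m (by positivity) hmn)
      gcongr
      refine norm_setIntegral_le_of_norm_le_const (measure_lt_top _ _) fun ω hω => ?_
      exact hav m (hmj.trans hj') _ ω ((hJ ω m (hmj.trans hj')).2 (hmj.trans (le_of_eq (Eq.symm hω))))
    · simp only [P, if_neg hmj, sub_zero]
      rw [norm_mul, Complex.norm_real, Real.norm_of_nonneg (by positivity)]
      refine le_trans (hgen (c := B / (1 + |((2 * (j : ℤ) - n : ℤ) : ℝ)|) ^ 4) (by positivity) ?_)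
        (hdecay _ (abs_nonneg _) ?_)
      · gcongr
        exact norm_setIntegral_le_of_norm_le_const (measure_lt_top _ _) fun ω _ => hFB _ ω
      · have : 1 + (n : ℤ) ≤ 8 * (1 + |2 * (j : ℤ) - n|) := by
          have := neg_le_abs (2 * (j : ℤ) - n)
          omega
        exact_mod_cast this
  have hmain : ‖∑ j ∈ Finset.range (n + 1), P j‖ ≤ 3 * (B * β) := by
    have hβ0 : 0 ≤ B * β := by positivity
    by_cases hmn' : m ≤ n
    swap
    · rw [Finset.sum_eq_zero]
      · simp; linarith
      · intro j hj
        have hj' := Finset.mem_range.1 hj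
        simp only [P]
        rw [if_neg (by omega)]
    let AH : ℤ → ℂ := fun k => ⨍ ω' in C m, H k ω' ∂ν
    have hAH : ∀ k, A k = AH k - AH (k + 2) := by
      intro k
      simp only [A, AH, setAverage_eq]
      rw [← smul_sub, ← integral_sub (hH _).integrableOn (hH _).integrableOn]
      simp only [hFH]
    have hνm : 0 < ν.real (C m) := by
      rw [hm, hν (n / 4) (by omega)]
      positivity
    have havg : ∀ {f : Ω → ℂ} {b : ℝ}, (∀ ω, ‖f ω‖ ≤ b) → ‖⨍ ω' in C m, f ω' ∂ν‖ ≤ b := by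
      intro f b hf
      rw [setAverage_eq, norm_smul, norm_inv, Real.norm_of_nonneg hνm.le, inv_mul_le_iff₀ hνm,
        mul_comm]
      exact norm_setIntegral_le_of_norm_le_const (measure_lt_top _ _) fun ω _ => hf ω
    have hsum : ∑ j ∈ Finset.range (n + 1), P j =
        (((q - 1) / (q + 1) : ℝ) : ℂ) * (AH (2 * m - n) - AH n) + ((q / (q + 1) : ℝ) : ℂ) * A n := by
      rw [Finset.sum_range_succ]
      congr 1
      · rw [← Finset.sum_range_add_sum_Ico _ hmn', Finset.sum_eq_zero, zero_add]
        · have : ∀ j ∈ Finset.Ico m n, P j = (((q - 1) / (q + 1) : ℝ) : ℂ) *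
              (-(AH (2 * ((j + 1 : ℕ) : ℤ) - n)) - -(AH (2 * (j : ℤ) - n))) := by
            intro j hj
            obtain ⟨h1, h2⟩ := Finset.mem_Ico.1 hj
            obtain ⟨i, rfl⟩ : ∃ i, j = i + 1 := ⟨j - 1, by omega⟩
            simp only [P, if_pos h1]
            rw [hmass i h2, hAH]
            congr 1
            rw [show 2 * ((i + 1 : ℕ) : ℤ) - n + 2 = 2 * ((i + 1 + 1 : ℕ) : ℤ) - n by push_cast; ring]
            ring
          rw [Finset.sum_congr rfl this, ← Finset.mul_sum,
            Finset.sum_Ico_sub (fun j : ℕ => -(AH (2 * (j : ℤ) - n))) hmn']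
          congr 1
          rw [show 2 * (n : ℤ) - n = n by ring]
          ring
        · intro j hj
          have := Finset.mem_range.1 hj
          simp only [P]
          rw [if_neg (by omega)]
      · simp only [P, if_pos hmn']
        obtain ⟨i, hi⟩ : ∃ i, n = i + 1 := ⟨n - 1, by omega⟩
        have := hmassn i hi.symm
        rw [← hi] at this
        rw [this, show 2 * (n : ℤ) - n = n by ring]
    have hHn : ∀ k : ℤ, 1 + (n : ℤ) ≤ 8 * (1 + |k|) → ∀ ω, ‖H k ω‖ ≤ B * β := fun k hk ω =>
      (hHB k ω).trans (hdecay _ (abs_nonneg _) (by exact_mod_cast hk))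
    have hn1 : 1 + (n : ℤ) ≤ 8 * (1 + |(n : ℤ)|) := by
      have := le_abs_self (n : ℤ)
      omega
    have hm1 : 1 + (n : ℤ) ≤ 8 * (1 + |2 * (m : ℤ) - n|) := by
      have := neg_le_abs (2 * (m : ℤ) - n)
      have := abs_nonneg (2 * (m : ℤ) - n)
      omega
    have b1 := havg (hHn _ hm1)
    have b2 := havg (hHn _ hn1)
    have b3 : ‖A n‖ ≤ B * β := havg fun ω =>
      (hFB n ω).trans (hdecay _ (abs_nonneg _) (by exact_mod_cast hn1))
    have c1 : ‖(((q - 1) / (q + 1) : ℝ) : ℂ)‖ ≤ 1 := by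
      rw [Complex.norm_real, Real.norm_of_nonneg (div_nonneg (by linarith) (by linarith)),
        div_le_one (by positivity)]
      linarith
    have c2 : ‖((q / (q + 1) : ℝ) : ℂ)‖ ≤ 1 := by
      rw [Complex.norm_real, Real.norm_of_nonneg (by positivity), div_le_one (by positivity)]
      linarith
    rw [hsum]
    calc _ ≤ 1 * (B * β + B * β) + 1 * (B * β) := by
          refine (norm_add_le _ _).trans ?_
          rw [norm_mul, norm_mul]
          gcongr
          exact (norm_sub_le _ _).trans (add_le_add b1 b2)
      _ = _ := by ring
  rw [hsplit]
  have e : ∑ j ∈ Finset.range (n + 1),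
      (((q : ℝ) ^ j : ℝ) : ℂ) * (∫ ω in L j, F (2 * (j : ℤ) - n) ω ∂ν) =
      ∑ j ∈ Finset.range (n + 1), ((((q : ℝ) ^ j : ℝ) : ℂ) *
        (∫ ω in L j, F (2 * (j : ℤ) - n) ω ∂ν) - P j) + ∑ j ∈ Finset.range (n + 1), P j := by
    rw [← Finset.sum_add_distrib]
    simp
  rw [e]
  calc _ ≤ ((n : ℝ) + 1) * (B * β) + 3 * (B * β) := by
        refine (norm_add_le _ _).trans (add_le_add ?_ hmain)
        refine (norm_sum_le_of_le _ herr).trans (le_of_eq ?_)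
        simp
    _ ≤ 4 * ((n : ℝ) + 1) * (B * β) := by
        have : 0 ≤ (n : ℝ) * (B * β) := by positivity
        linarith
    _ = _ := by
        rw [hβ]
        field_simp
        ring

end cancellation

/-! ### The density of the Plancherel measure -/

section density

/-- The smooth factor of the Plancherel density which remains after division by `1 - q ^ {2is}`. -/
noncomputable def halfDensity (q : ℕ) (s : ℝ) : ℂ :=
  ((Real.log q * (q + 1) / (4 * Real.pi) /
      (((q : ℝ) - 1) ^ 2 / q + 4 * Real.sin (s * Real.log q) ^ 2) : ℝ) : ℂ) *
    (1 - Complex.exp (Complex.I * (((-2 * Real.log q : ℝ) : ℂ) * s)))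

/-- The density of the Plancherel measure in closed form, as a smooth function on the line that
vanishes at the poles of `𝐜`. -/
noncomputable def density (q : ℕ) (s : ℝ) : ℂ :=
  (1 - Complex.exp (Complex.I * (((2 * Real.log q : ℝ) : ℂ) * s))) * halfDensity q s

lemma density_denom_pos {q : ℕ} (hq : 2 ≤ q) (s : ℝ) :
    0 < ((q : ℝ) - 1) ^ 2 / q + 4 * Real.sin (s * Real.log q) ^ 2 := by
  have : (2 : ℝ) ≤ q := by exact_mod_cast hq
  have : 0 < (q : ℝ) - 1 := by linarith
  positivity

lemma contDiff_halfDensity {q : ℕ} (hq : 2 ≤ q) : ContDiff ℝ 4 (halfDensity q) := by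
  have h1 : ContDiff ℝ 4 (fun s : ℝ => Real.log q * (q + 1) / (4 * Real.pi) /
      (((q : ℝ) - 1) ^ 2 / q + 4 * Real.sin (s * Real.log q) ^ 2)) :=
    ContDiff.div (by fun_prop) (by fun_prop) fun s => (density_denom_pos hq s).ne'
  have h2 : ContDiff ℝ 4 (fun s : ℝ =>
      (1 : ℂ) - Complex.exp (Complex.I * (((-2 * Real.log q : ℝ) : ℂ) * s))) := by
    have := Complex.ofRealCLM.contDiff (n := 4)
    have e : ContDiff ℝ 4 (fun s : ℝ => (s : ℂ)) := this
    fun_prop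
  exact (Complex.ofRealCLM.contDiff.comp h1).mul h2

lemma contDiff_density {q : ℕ} (hq : 2 ≤ q) : ContDiff ℝ 4 (density q) := by
  have h2 : ContDiff ℝ 4 (fun s : ℝ =>
      (1 : ℂ) - Complex.exp (Complex.I * (((2 * Real.log q : ℝ) : ℂ) * s))) := by
    have := Complex.ofRealCLM.contDiff (n := 4)
    have e : ContDiff ℝ 4 (fun s : ℝ => (s : ℂ)) := this
    fun_prop
  exact h2.mul (contDiff_halfDensity hq)

lemma norm_sq_cFun {q : ℕ} (hq : 2 ≤ q) (s : ℝ) :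
    ‖cFun q s‖ ^ 2 = q / ((q : ℝ) + 1) ^ 2 *
      ((((q : ℝ) - 1) ^ 2 / q + 4 * Real.sin (s * Real.log q) ^ 2) /
        (4 * Real.sin (s * Real.log q) ^ 2)) := by
  have hq0 : (0 : ℝ) < q := by positivity
  have hqc : (q : ℂ) ≠ 0 := by exact_mod_cast hq0.ne'
  set θ := s * Real.log q with hθ
  have hsq : Real.sqrt q ^ 2 = q := Real.sq_sqrt hq0.le
  have hsq0 : 0 < Real.sqrt q := Real.sqrt_pos.2 hq0
  have e1 : (q : ℂ) ^ (1 / 2 : ℂ) = (Real.sqrt q : ℂ) := by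
    rw [Real.sqrt_eq_rpow, Complex.ofReal_cpow hq0.le]
    norm_num
  have e2 : (q : ℂ) ^ (Complex.I * s) = Complex.cos θ + Complex.sin θ * Complex.I := by
    rw [Complex.cpow_def_of_ne_zero hqc, ← Complex.natCast_log, ← Complex.exp_mul_I, hθ]
    congr 1
    push_cast
    ring
  have e3 : (q : ℂ) ^ (-(Complex.I * s)) = Complex.cos θ - Complex.sin θ * Complex.I := by
    have h : -(Complex.I * (s : ℂ)) = Complex.I * ((-s : ℝ) : ℂ) := by push_cast; ring
    rw [Complex.cpow_def_of_ne_zero hqc, ← Complex.natCast_log, sub_eq_add_neg,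
      ← neg_mul (Complex.sin θ), ← Complex.sin_neg, ← Complex.cos_neg, ← Complex.exp_mul_I, hθ]
    congr 1
    push_cast
    ring
  have e4 : (q : ℂ) ^ (1 / 2 + Complex.I * s) - (q : ℂ) ^ (-(1 / 2) - Complex.I * s) =
      ((Real.sqrt q - (Real.sqrt q)⁻¹) * Real.cos θ : ℝ) +
        ((Real.sqrt q + (Real.sqrt q)⁻¹) * Real.sin θ : ℝ) * Complex.I := by
    rw [sub_eq_add_neg (-(1 / 2) : ℂ), Complex.cpow_add _ _ hqc, Complex.cpow_add _ _ hqc,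
      Complex.cpow_neg, e1, e2, e3]
    push_cast
    ring
  have e5 : (q : ℂ) ^ (Complex.I * s) - (q : ℂ) ^ (-(Complex.I * s)) =
      (0 : ℝ) + (2 * Real.sin θ : ℝ) * Complex.I := by
    rw [e2, e3]
    push_cast
    ring
  have e6 : ‖((q : ℂ) + 1)‖ = (q : ℝ) + 1 := by
    rw [show ((q : ℂ) + 1) = (((q : ℝ) + 1 : ℝ) : ℂ) by push_cast; rfl, Complex.norm_real,
      Real.norm_of_nonneg (by positivity)]
  have hn : ∀ a b : ℝ, ‖(a : ℂ) + b * Complex.I‖ ^ 2 = a ^ 2 + b ^ 2 := fun a b => by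
    rw [Complex.sq_norm, Complex.normSq_add_mul_I]
  have hcos := Real.sin_sq_add_cos_sq θ
  rw [cFun, e1, e4, e5, norm_mul, norm_div, norm_div, e6, mul_pow, div_pow, div_pow, hn, hn,
    Complex.norm_real, Real.norm_of_nonneg hsq0.le, hsq]
  congr 1
  congr 1
  · have : Real.cos θ ^ 2 = 1 - Real.sin θ ^ 2 := by linarith
    rw [mul_pow, mul_pow, this]
    have hi : Real.sqrt q * (Real.sqrt q)⁻¹ = 1 := mul_inv_cancel₀ hsq0.ne'
    have hi2 : ((Real.sqrt q)⁻¹) ^ 2 = (q : ℝ)⁻¹ := by rw [inv_pow, hsq]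
    rw [sub_sq, add_sq, mul_assoc 2, hi, hsq, hi2]
    field_simp
    ring
  · ring

/-- The equality includes the poles of `𝐜`: there `cFun` is `0` by the convention for division by zero,
and so is the inverse of its squared norm, in agreement with the zero of `density`. -/
lemma plancherel_density_eq {q : ℕ} (hq : 2 ≤ q) (s : ℝ) :
    ((q * Real.log q / (4 * Real.pi * (q + 1)) * (‖cFun q s‖ ^ 2)⁻¹ : ℝ) : ℂ) = density q s := by
  have hq0 : (0 : ℝ) < q := by positivity
  have hD := density_denom_pos hq s
  rw [norm_sq_cFun hq, density, halfDensity]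
  set θ := s * Real.log q with hθ
  have e1 : (1 - Complex.exp (Complex.I * (((2 * Real.log q : ℝ) : ℂ) * s))) *
      (1 - Complex.exp (Complex.I * (((-2 * Real.log q : ℝ) : ℂ) * s))) =
      ((4 * Real.sin θ ^ 2 : ℝ) : ℂ) := by
    have a1 : Complex.I * (((2 * Real.log q : ℝ) : ℂ) * s) = ((2 * θ : ℝ) : ℂ) * Complex.I := by
      rw [hθ]; push_cast; ring
    have a2 : Complex.I * (((-2 * Real.log q : ℝ) : ℂ) * s) = -((2 * θ : ℝ) : ℂ) * Complex.I := by
      rw [hθ]; push_cast; ring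
    rw [a1, a2, Complex.exp_mul_I, Complex.exp_mul_I, Complex.cos_neg, Complex.sin_neg]
    push_cast
    rw [Complex.cos_two_mul, Complex.sin_two_mul]
    have hc := Complex.sin_sq_add_cos_sq (θ : ℂ)
    have hI := Complex.I_sq
    have hc' : Complex.cos (θ : ℂ) ^ 2 = 1 - Complex.sin (θ : ℂ) ^ 2 := by linear_combination hc
    ring_nf
    rw [hI, show Complex.cos (θ : ℂ) ^ 4 = (Complex.cos (θ : ℂ) ^ 2) ^ 2 by ring, hc']
    ring
  rw [mul_left_comm, e1, ← Complex.ofReal_mul]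
  congr 1
  rw [mul_inv, inv_div, inv_div]
  field_simp

lemma tau_pos {q : ℕ} (hq : 2 ≤ q) : 0 < tau q :=
  div_pos Real.pi_pos (Real.log_pos (by exact_mod_cast hq))

lemma integral_plancherel {q : ℕ} (hq : 2 ≤ q) (f : ℝ → ℂ) :
    ∫ s, f s ∂(plancherel q) = ∫ s in (0 : ℝ)..tau q, f s * density q s := by
  have hcm : Measurable fun s : ℝ => ENNReal.ofReal
      (q * Real.log q / (4 * Real.pi * (q + 1)) * (‖cFun q s‖ ^ 2)⁻¹) := by
    simp only [norm_sq_cFun hq]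
    fun_prop
  rw [plancherel, integral_withDensity_eq_integral_toReal_smul hcm
    (ae_of_all _ fun _ => ENNReal.ofReal_lt_top), integral_Icc_eq_integral_Ioc,
    intervalIntegral.integral_of_le (tau_pos hq).le]
  congr 1
  funext s
  have hlog : 0 ≤ Real.log q := Real.log_natCast_nonneg q
  rw [ENNReal.toReal_ofReal (by positivity), Complex.real_smul, plancherel_density_eq hq, mul_comm]

lemma natCast_cpow_eq {q : ℕ} (hq : 2 ≤ q) (s : ℝ) (k : ℤ) :
    (q : ℂ) ^ ((1 / 2 + Complex.I * (s : ℂ)) * (k : ℂ)) =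
      (((q : ℝ) ^ ((k : ℝ) / 2) : ℝ) : ℂ) *
        Complex.exp (Complex.I * (((k * Real.log q : ℝ) : ℂ) * s)) := by
  have hq0 : (0 : ℝ) < q := by positivity
  have hqc : (q : ℂ) ≠ 0 := by exact_mod_cast hq0.ne'
  rw [Real.rpow_def_of_pos hq0, Complex.ofReal_exp, ← Complex.exp_add,
    Complex.cpow_def_of_ne_zero hqc, ← Complex.natCast_log]
  congr 1
  push_cast
  ring

end density

/-! ### Averages of Fourier integrals and the kernel bound -/

section averages

variable {Ω : Type*} [TopologicalSpace Ω] [MeasurableSpace Ω] [OpensMeasurableSpace Ω]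

/-- The Fourier integral `∫ e^{i k L s} b(s) w(s) ds` over `[0, T]`. -/
noncomputable def fourierIntegral (T L : ℝ) (w b : ℝ → ℂ) (k : ℤ) : ℂ :=
  ∫ s in (0 : ℝ)..T, Complex.exp (Complex.I * (((k * L : ℝ) : ℂ) * s)) * (b s * w s)

lemma integrable_prod_fourier (μ : Measure Ω) [IsFiniteMeasure μ] {T : ℝ} (l : ℝ) {w : ℝ → ℂ}
    (hw : Continuous w) {b : Ω → ℝ → ℂ}
    (hb : ContinuousOn (fun p : Ω × ℝ => b p.1 p.2) (univ ×ˢ Icc 0 T)) {M : ℝ}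
    (hM : ∀ ω, ∀ s ∈ Icc 0 T, ‖b ω s‖ ≤ M) :
    Integrable (fun p : Ω × ℝ => Complex.exp (Complex.I * ((l : ℂ) * p.2)) * (b p.1 p.2 * w p.2))
      (μ.prod (volume.restrict (Icc 0 T))) := by
  have hmeas : μ.prod (volume.restrict (Icc (0 : ℝ) T)) =
      (μ.prod volume).restrict (univ ×ˢ Icc 0 T) := by
    rw [← Measure.prod_restrict, Measure.restrict_univ]
  have hset : MeasurableSet ((univ : Set Ω) ×ˢ Icc (0 : ℝ) T) :=
    MeasurableSet.univ.prod measurableSet_Icc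
  obtain ⟨D, hD⟩ := isCompact_Icc.exists_bound_of_continuousOn (s := Icc 0 T) hw.continuousOn
  have hc : ContinuousOn (fun p : Ω × ℝ =>
      Complex.exp (Complex.I * ((l : ℂ) * p.2)) * (b p.1 p.2 * w p.2)) (univ ×ˢ Icc 0 T) := by
    refine ContinuousOn.mul (Continuous.continuousOn (by fun_prop)) (hb.mul ?_)
    exact (hw.comp continuous_snd).continuousOn
  refine Integrable.of_bound (C := M * D) ?_ ?_
  · rw [hmeas]
    exact hc.aestronglyMeasurable hset
  · rw [hmeas]
    refine (ae_restrict_iff' hset).2 (ae_of_all _ fun p hp => ?_)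
    have e : ‖Complex.exp (Complex.I * ((l : ℂ) * p.2))‖ = 1 := by
      rw [mul_comm, ← Complex.ofReal_mul]
      exact Complex.norm_exp_ofReal_mul_I _
    have h1 := hM p.1 p.2 hp.2
    have h2 := hD p.2 hp.2
    rw [norm_mul, e, one_mul, norm_mul]
    exact mul_le_mul h1 h2 (norm_nonneg _) ((norm_nonneg _).trans h1)

lemma integrable_fourierIntegral (μ : Measure Ω) [IsFiniteMeasure μ] {T L : ℝ} (hT : 0 < T)
    {w : ℝ → ℂ} (hw : Continuous w) {b : Ω → ℝ → ℂ}
    (hb : ContinuousOn (fun p : Ω × ℝ => b p.1 p.2) (univ ×ˢ Icc 0 T)) {M : ℝ}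
    (hM : ∀ ω, ∀ s ∈ Icc 0 T, ‖b ω s‖ ≤ M) (k : ℤ) :
    Integrable (fun ω => fourierIntegral T L w (b ω) k) μ := by
  have := (integrable_prod_fourier μ (k * L) hw hb hM).integral_prod_left
  simpa only [fourierIntegral, intervalIntegral.integral_of_le hT.le,
    ← integral_Icc_eq_integral_Ioc] using this

/-- Averaging over `ω` commutes with the Fourier integral, so an amplitude that is close to its
average over `C` has a Fourier integral that is close to its average over `C`. -/
lemma norm_fourierIntegral_sub_average_le (ν : Measure Ω) [IsFiniteMeasure ν] {T L : ℝ}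
    (hT : 0 < T) {w : ℝ → ℂ} (hw : Continuous w) {D : ℝ} (hD : ∀ s ∈ Icc 0 T, ‖w s‖ ≤ D)
    {b : Ω → ℝ → ℂ} (hb : ContinuousOn (fun p : Ω × ℝ => b p.1 p.2) (univ ×ˢ Icc 0 T)) {M : ℝ}
    (hM : ∀ ω, ∀ s ∈ Icc 0 T, ‖b ω s‖ ≤ M) (C : Set Ω) {N : ℝ} (ω : Ω)
    (hN : ∀ s ∈ Icc 0 T, ‖b ω s - ⨍ ω' in C, b ω' s ∂ν‖ ≤ N) (k : ℤ) :
    ‖fourierIntegral T L w (b ω) k - ⨍ ω' in C, fourierIntegral T L w (b ω') k ∂ν‖ ≤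
      N * D * T := by
  have hint := integrable_prod_fourier (ν.restrict C) (k * L) hw hb hM
  have hpull : ∀ s : ℝ, Complex.exp (Complex.I * (((k * L : ℝ) : ℂ) * s)) *
      ((⨍ ω' in C, b ω' s ∂ν) * w s) = ⨍ ω' in C,
        Complex.exp (Complex.I * (((k * L : ℝ) : ℂ) * s)) * (b ω' s * w s) ∂ν := by
    intro s
    rw [setAverage_eq, setAverage_eq, integral_const_mul, integral_mul_const, Complex.real_smul,
      Complex.real_smul]
    ring
  have hswap : ⨍ ω' in C, fourierIntegral T L w (b ω') k ∂ν =
      fourierIntegral T L w (fun s => ⨍ ω' in C, b ω' s ∂ν) k := by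
    simp only [fourierIntegral, hpull, intervalIntegral.integral_of_le hT.le,
      ← integral_Icc_eq_integral_Ioc]
    simp only [setAverage_eq]
    rw [integral_integral_swap hint, integral_smul]
  have hint2 : IntervalIntegrable (fun s : ℝ => Complex.exp (Complex.I * (((k * L : ℝ) : ℂ) * s)) *
      ((⨍ ω' in C, b ω' s ∂ν) * w s)) volume 0 T := by
    simp only [hpull]
    rw [intervalIntegrable_iff_integrableOn_Icc_of_le hT.le]
    simp only [setAverage_eq]
    exact (hint.integral_prod_right).smul _
  have hint1 : IntervalIntegrable (fun s : ℝ => Complex.exp (Complex.I * (((k * L : ℝ) : ℂ) * s)) *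
      (b ω s * w s)) volume 0 T := by
    refine ContinuousOn.intervalIntegrable ?_
    rw [uIcc_of_le hT.le]
    refine ContinuousOn.mul (Continuous.continuousOn (by fun_prop)) (ContinuousOn.mul ?_
      hw.continuousOn)
    exact hb.comp (f := fun s : ℝ => (ω, s)) (Continuous.continuousOn (by fun_prop))
      (fun s hs => ⟨mem_univ _, hs⟩)
  rw [hswap, fourierIntegral, fourierIntegral, ← intervalIntegral.integral_sub hint1 hint2]
  simp only [← mul_sub, ← sub_mul]
  refine norm_integral_exp_mul_le_sup hT (fun s hs => ?_) _
  rw [norm_mul]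
  exact mul_le_mul (hN s hs) (hD s hs) (norm_nonneg _) ((norm_nonneg _).trans (hN s hs))

end averages

/-- The factor `1 - q ^ {2is}` of the density becomes a difference of two frequencies, which makes
the sum over the steps of a geodesic telescope. -/
lemma fourierIntegral_density {q : ℕ} (hq : 2 ≤ q) {b : ℝ → ℂ}
    (hb : ContinuousOn b (Icc 0 (tau q))) (k : ℤ) :
    fourierIntegral (tau q) (Real.log q) (density q) b k =
      fourierIntegral (tau q) (Real.log q) (halfDensity q) b k -
        fourierIntegral (tau q) (Real.log q) (halfDensity q) b (k + 2) := by
  have hint : ∀ k : ℤ, IntervalIntegrable (fun s : ℝ =>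
      Complex.exp (Complex.I * (((k * Real.log q : ℝ) : ℂ) * s)) * (b s * halfDensity q s))
      volume 0 (tau q) := by
    intro k
    refine ContinuousOn.intervalIntegrable ?_
    rw [uIcc_of_le (tau_pos hq).le]
    exact ContinuousOn.mul (Continuous.continuousOn (by fun_prop))
      (hb.mul (contDiff_halfDensity hq).continuous.continuousOn)
  simp only [fourierIntegral]
  rw [← intervalIntegral.integral_sub (hint _) (hint _)]
  congr 1
  funext s
  have : Complex.exp (Complex.I * ((((k + 2 : ℤ) * Real.log q : ℝ) : ℂ) * s)) =
      Complex.exp (Complex.I * (((k * Real.log q : ℝ) : ℂ) * s)) *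
        Complex.exp (Complex.I * (((2 * Real.log q : ℝ) : ℂ) * s)) := by
    rw [← Complex.exp_add]
    congr 1
    push_cast
    ring
  rw [this, density]
  ring

section kernel

/-- The kernel of the operator `OP(a)`. -/
noncomputable def opKernel {X : Type*} (G : SimpleGraph X) (q : ℕ) {o : X}
    (a : X → X → Boundary G o → ℝ → ℂ) (x y : X) : ℂ :=
  ∫ ω : Boundary G o, (∫ s : ℝ,
    (q : ℂ) ^ ((1 / 2 + Complex.I * (s : ℂ)) * ((height G ω y - height G ω x : ℤ) : ℂ)) *
      a x y ω s ∂(plancherel q)) ∂(visibilityMeasure G q o x)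

lemma OP_eq_tsum_opKernel {X : Type*} (G : SimpleGraph X) (q : ℕ) {o : X}
    (a : X → X → Boundary G o → ℝ → ℂ) (u : X → ℂ) (x : X) :
    OP G q a u x = ∑' y, opKernel G q a x y * u y := by
  simp only [OP, opKernel, integral_mul_const]

/-- The kernel decays like `q ^ (-d/2) (1 + d) ^ (-3)`, `d = d(x, y)`. -/
lemma exists_norm_opKernel_le (q : ℕ) (hq : 2 ≤ q) :
    ∃ C : ℝ, 0 < C ∧
      ∀ (X : Type*) (G : SimpleGraph X) [G.LocallyFinite],
        G.IsTree → G.IsRegularOfDegree (q + 1) →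
        ∀ (o : X) (a : X → X → Boundary G o → ℝ → ℂ), IsDoubleSymbol G q a →
        ∀ M : ℝ, (∀ k ≤ 4, ∀ x y ω, ∀ s ∈ Icc 0 (tau q), ‖dS G q k a x y ω s‖ ≤ M) →
          (∀ (n : ℕ) (x y : X) (ω : Boundary G o), ∀ s ∈ Icc 0 (tau q),
            ‖a x y ω s - average G q x n (fun ω' => a x y ω' s) ω‖ ≤ M / (1 + (n : ℝ)) ^ 4) →
          ∀ x y, ‖opKernel G q a x y‖ ≤
            C * M * (q : ℝ) ^ (-(G.dist x y : ℝ) / 2) / (1 + (G.dist x y : ℝ)) ^ 3 := by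
  have hT := tau_pos hq
  have hL : 0 < Real.log q := Real.log_pos (by exact_mod_cast hq)
  have hq0 : (0 : ℝ) < q := by positivity
  have hW := contDiff_density hq
  have hV := contDiff_halfDensity hq
  obtain ⟨C₁, hC₁, h₁⟩ := exists_fourier_decay hT hL hW
  obtain ⟨C₂, hC₂, h₂⟩ := exists_fourier_decay hT hL hV
  obtain ⟨D, hD⟩ := isCompact_Icc.exists_bound_of_continuousOn (s := Icc 0 (tau q))
    hW.continuous.continuousOn
  have hD0 : 0 ≤ D := (norm_nonneg _).trans (hD 0 ⟨le_rfl, hT.le⟩)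
  refine ⟨16384 * (C₁ + C₂ + D * tau q), by positivity, ?_⟩
  intro X G _ hG hreg o a ha M hder havg x y
  obtain ⟨hprob, hν⟩ := isVisibilityMeasure_visibilityMeasure hG (by omega) hreg o x
  set ν := visibilityMeasure G q o x with hνdef
  obtain ⟨ω₀⟩ := nonempty_boundary hG (by omega) hreg o
  have hM0 : 0 ≤ M := (norm_nonneg _).trans (hder 0 (by norm_num) x y ω₀ 0 ⟨le_rfl, hT.le⟩)
  obtain ⟨δ, d0, d1, d2, d3⟩ := exists_geodesic hG x y
  set n := G.dist x y with hn
  choose J hJn hJ hh using exists_turn_segment hG (o := o) d1 d2 d3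
  have hcont : ContinuousOn (fun p : Boundary G o × ℝ => a x y p.1 p.2) (univ ×ˢ Icc 0 (tau q)) := by
    simpa [dS] using ha.continuous 0 x y
  have hbd : ∀ ω, ∀ s ∈ Icc 0 (tau q), ‖a x y ω s‖ ≤ M := fun ω s hs => by
    simpa [dS] using hder 0 (by norm_num) x y ω s hs
  have hsm : ∀ ω, ContDiffOn ℝ 4 (a x y ω) (Icc 0 (tau q)) := fun ω =>
    contDiffOn_infty.1 (ha.smooth x y ω) 4
  let F : ℤ → Boundary G o → ℂ := fun k ω =>
    fourierIntegral (tau q) (Real.log q) (density q) (a x y ω) k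
  let H : ℤ → Boundary G o → ℂ := fun k ω =>
    fourierIntegral (tau q) (Real.log q) (halfDensity q) (a x y ω) k
  set B := (C₁ + C₂ + D * tau q) * M with hB
  have hDt : 0 ≤ D * tau q := by positivity
  have hFB : ∀ k ω, ‖F k ω‖ ≤ B / (1 + |(k : ℝ)|) ^ 4 := by
    intro k ω
    refine (h₁ (a x y ω) M (hsm ω) (fun k _ => ha.boundary_zero k x y ω)
      (fun k hk s hs => hder k hk x y ω s hs) k).trans ?_
    rw [hB]
    gcongr
    linarith
  have hHB : ∀ k ω, ‖H k ω‖ ≤ B / (1 + |(k : ℝ)|) ^ 4 := by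
    intro k ω
    refine (h₂ (a x y ω) M (hsm ω) (fun k _ => ha.boundary_zero k x y ω)
      (fun k hk s hs => hder k hk x y ω s hs) k).trans ?_
    rw [hB]
    gcongr
    linarith
  have hav : ∀ m ≤ n, ∀ k, ∀ ω ∈ cylinder G x (δ m),
      ‖F k ω - ⨍ ω' in cylinder G x (δ m), F k ω' ∂ν‖ ≤ B / (1 + (m : ℝ)) ^ 4 := by
    intro m hm k ω hω
    have hcyl : cylinderAt G x m ω = cylinder G x (δ m) := by
      have := cylinderAt_eq hG hω
      rwa [d3 m hm] at this
    refine (norm_fourierIntegral_sub_average_le ν hT hW.continuous hD hcont hbd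
      (cylinder G x (δ m)) (N := M / (1 + (m : ℝ)) ^ 4) ω (fun s hs => ?_) k).trans ?_
    · have := havg m x y ω s hs
      rwa [average, hcyl] at this
    · have : M / (1 + (m : ℝ)) ^ 4 * D * tau q = D * tau q * M / (1 + (m : ℝ)) ^ 4 := by ring
      rw [this, hB]
      gcongr
      linarith
  have hmass : ∀ i < n, ν.real (cylinder G x (δ (i + 1))) = (((q : ℝ) + 1) * (q : ℝ) ^ i)⁻¹ := by
    intro i hi
    rw [measureReal_def, hν i (δ (i + 1)) (d3 _ hi)]
    simp [ENNReal.toReal_add]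
  have key := norm_integral_le_of_telescoping ν (q := q) (n := n) (by omega)
    (C := fun i => cylinder G x (δ i)) (fun i => measurableSet_cylinder x (δ i)) hJn hJ hmass
    (F := F) (H := H) (integrable_fourierIntegral ν hT hW.continuous hcont hbd)
    (integrable_fourierIntegral ν hT hV.continuous hcont hbd)
    (fun k ω => fourierIntegral_density hq (hsm ω).continuousOn k) hFB hHB hav
  have hK : opKernel G q a x y = (((q : ℝ) ^ (-(n : ℝ) / 2) : ℝ) : ℂ) *
      ∫ ω, (((q : ℝ) ^ J ω : ℝ) : ℂ) * F (2 * (J ω : ℤ) - n) ω ∂ν := by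
    rw [opKernel, ← integral_const_mul]
    refine integral_congr_ae (ae_of_all _ fun ω => ?_)
    simp only [F, fourierIntegral]
    rw [integral_plancherel hq, hh ω, ← mul_assoc, ← Complex.ofReal_mul]
    have e : (q : ℝ) ^ (-(n : ℝ) / 2) * (q : ℝ) ^ J ω =
        (q : ℝ) ^ (((2 * (J ω : ℤ) - n : ℤ) : ℝ) / 2) := by
      rw [← Real.rpow_natCast, ← Real.rpow_add hq0]
      congr 1
      push_cast
      ring
    rw [e, ← intervalIntegral.integral_const_mul]
    congr 1
    funext s
    rw [natCast_cpow_eq hq]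
    ring
  rw [hK, norm_mul, Complex.norm_real, Real.norm_of_nonneg (by positivity)]
  calc _ ≤ (q : ℝ) ^ (-(n : ℝ) / 2) * (16384 * B / (1 + (n : ℝ)) ^ 3) := by gcongr
    _ = _ := by rw [hB]; ring

end kernel

/-! ### The norms of a symbol and the bound for the operator -/

section norms

variable {X : Type*} {G : SimpleGraph X} {q : ℕ} {o : X} {a : X → X → Boundary G o → ℝ → ℂ}

lemma enorm_dS_le_supNormDS (k : ℕ) (x y : X) (ω : Boundary G o) {s : ℝ}
    (hs : s ∈ Icc 0 (tau q)) : ‖dS G q k a x y ω s‖ₑ ≤ supNormDS G q k a :=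
  le_iSup_of_le x <| le_iSup_of_le y <| le_iSup_of_le ω <| le_iSup₂_of_le s hs le_rfl

lemma enorm_sub_average_le_omegaNorm (l n : ℕ) (x y : X) (ω : Boundary G o) {s : ℝ}
    (hs : s ∈ Icc 0 (tau q)) :
    ((n : ℝ≥0∞) + 1) ^ l * ‖a x y ω s - average G q x n (fun ω' => a x y ω' s) ω‖ₑ ≤
      omegaNorm G q l a := by
  refine le_trans ?_ (le_iSup_of_le x <| le_iSup_of_le y <| le_iSup_of_le n le_rfl)
  gcongr
  exact le_iSup_of_le (f := fun ω => ⨆ s ∈ Icc 0 (tau q),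
    ‖a x y ω s - average G q x n (fun ω' => a x y ω' s) ω‖ₑ) ω (le_iSup₂_of_le s hs le_rfl)

lemma IsDoubleSymbol.omegaNorm_lt_top (ha : IsDoubleSymbol G q a) (l : ℕ) :
    omegaNorm G q l a < ∞ := by
  obtain ⟨C, hC⟩ := ha.regular l
  refine lt_of_le_of_lt (b := ENNReal.ofReal C) ?_ ENNReal.ofReal_lt_top
  refine iSup_le fun x => iSup_le fun y => iSup_le fun n => ?_
  have e : ((n : ℝ≥0∞) + 1) ^ l = ENNReal.ofReal ((1 + (n : ℝ)) ^ l) := by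
    rw [ENNReal.ofReal_pow (by positivity), ENNReal.ofReal_add (by norm_num) (by positivity)]
    simp [add_comm]
  have hsup : (⨆ (ω : Boundary G o) (s ∈ Icc 0 (tau q)),
      ‖a x y ω s - average G q x n (fun ω' => a x y ω' s) ω‖ₑ) ≤
        ENNReal.ofReal (C / (1 + (n : ℝ)) ^ l) := by
    refine iSup_le fun ω => iSup₂_le fun s hs => ?_
    rw [← ofReal_norm]
    exact ENNReal.ofReal_le_ofReal (hC n x y ω s hs)
  calc _ ≤ ((n : ℝ≥0∞) + 1) ^ l * ENNReal.ofReal (C / (1 + (n : ℝ)) ^ l) := by gcongr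
    _ = _ := by
      rw [e, ← ENNReal.ofReal_mul (by positivity)]
      congr 1
      field_simp

end norms

end HomTree

open HomTree in
theorem mainTheorem1 (q : ℕ) (hq : 2 ≤ q) :
    ∃ C : ℝ≥0, 0 < C ∧
      ∀ (X : Type*) (G : SimpleGraph X) [G.LocallyFinite],
        G.IsTree → G.IsRegularOfDegree (q + 1) →
        ∀ (o : X) (a : X → X → Boundary G o → ℝ → ℂ),
          IsDoubleSymbol G q a →
          (∀ k ≤ 4, supNormDS G q k a < ∞) →
          ∃ T : lp (fun _ : X => ℂ) 2 →L[ℂ] lp (fun _ : X => ℂ) 2,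
            (∀ u : lp (fun _ : X => ℂ) 2, {y : X | u y ≠ 0}.Finite →
              ∀ x : X, T u x = OP G q a (fun y => u y) x) ∧
            ‖T‖ₑ ≤ (C : ℝ≥0∞) *
              (omegaNorm G q 4 a + ∑ k ∈ Finset.range 5, supNormDS G q k a) := by
  have hq0 : (0 : ℝ) < q := by positivity
  obtain ⟨C, hC, hker⟩ := exists_norm_opKernel_le q hq
  have hsum : Summable fun n : ℕ => 1 / (1 + (n : ℝ)) ^ 2 := by
    have := (summable_nat_add_iff 1).2 (Real.summable_one_div_nat_pow.2 (one_lt_two))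
    refine this.congr fun n => ?_
    push_cast
    rw [add_comm]
  set S : ℝ := ∑' n : ℕ, 1 / (1 + (n : ℝ)) ^ 2 with hS
  have hS0 : 0 < S := hsum.tsum_pos (fun n => by positivity) 0 (by norm_num)
  refine ⟨(2 * C * S).toNNReal, Real.toNNReal_pos.2 (by positivity), ?_⟩
  intro X G _ hG hreg o a ha hfin
  set R : ℝ≥0∞ := omegaNorm G q 4 a + ∑ k ∈ Finset.range 5, supNormDS G q k a with hR
  have hRt : R ≠ ∞ := by
    refine ENNReal.add_ne_top.2 ⟨(ha.omegaNorm_lt_top 4).ne, ENNReal.sum_ne_top.2 fun k hk => ?_⟩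
    exact (hfin k (Nat.lt_succ_iff.1 (Finset.mem_range.1 hk))).ne
  have hder : ∀ k ≤ 4, ∀ x y ω, ∀ s ∈ Icc 0 (tau q), ‖dS G q k a x y ω s‖ ≤ R.toReal := by
    intro k hk x y ω s hs
    have : ‖dS G q k a x y ω s‖ₑ ≤ R :=
      (enorm_dS_le_supNormDS k x y ω hs).trans ((Finset.single_le_sum
        (f := fun k => supNormDS G q k a) (fun _ _ => zero_le)
        (Finset.mem_range.2 (Nat.lt_succ_of_le hk))).trans le_add_self)
    simpa using ENNReal.toReal_mono hRt this
  have havg : ∀ (n : ℕ) (x y : X) (ω : Boundary G o), ∀ s ∈ Icc 0 (tau q),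
      ‖a x y ω s - average G q x n (fun ω' => a x y ω' s) ω‖ ≤ R.toReal / (1 + (n : ℝ)) ^ 4 := by
    intro n x y ω s hs
    have := ENNReal.toReal_mono hRt
      ((enorm_sub_average_le_omegaNorm (a := a) 4 n x y ω hs).trans (le_self_add (a := _)))
    rw [le_div_iff₀ (by positivity), mul_comm, add_comm (1 : ℝ)]
    simpa [ENNReal.toReal_add] using this
  have hK := hker X G hG hreg o a ha R.toReal hder havg
  set M := R.toReal with hM
  have hM0 : 0 ≤ M := ENNReal.toReal_nonneg
  obtain ⟨ω⟩ := nonempty_boundary hG (by omega) hreg o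
  let w : X → ℝ≥0∞ := fun y => ENNReal.ofReal ((q : ℝ) ^ ((height G ω y : ℝ) / 2))
  let φ : ℕ → ℝ≥0∞ := fun n =>
    ENNReal.ofReal (C * M * (q : ℝ) ^ (-(n : ℝ) / 2) / (1 + (n : ℝ)) ^ 3)
  have hKφ : ∀ x y, ‖opKernel G q a x y‖ₑ ≤ φ (G.dist x y) := fun x y => by
    rw [← ofReal_norm]
    exact ENNReal.ofReal_le_ofReal (hK x y)
  have hφ : ∑' n : ℕ, 2 * ((n : ℝ≥0∞) + 1) * ENNReal.ofReal ((q : ℝ) ^ ((n : ℝ) / 2)) * φ n =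
      ((2 * C * S).toNNReal : ℝ≥0∞) * R := by
    have ht : ∀ n : ℕ, 2 * ((n : ℝ≥0∞) + 1) * ENNReal.ofReal ((q : ℝ) ^ ((n : ℝ) / 2)) * φ n =
        ENNReal.ofReal (2 * C * M * (1 / (1 + (n : ℝ)) ^ 2)) := by
      intro n
      have e : (2 : ℝ≥0∞) * ((n : ℝ≥0∞) + 1) = ENNReal.ofReal (2 * (1 + (n : ℝ))) := by
        rw [ENNReal.ofReal_mul (by norm_num), ENNReal.ofReal_add (by norm_num) (by positivity)]
        simp [add_comm]
      have e2 : (q : ℝ) ^ ((n : ℝ) / 2) * (q : ℝ) ^ (-(n : ℝ) / 2) = 1 := by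
        rw [← Real.rpow_add hq0]
        ring_nf
        simp
      simp only [φ]
      rw [e, ← ENNReal.ofReal_mul (by positivity), ← ENNReal.ofReal_mul (by positivity)]
      congr 1
      calc _ = 2 * C * M * ((q : ℝ) ^ ((n : ℝ) / 2) * (q : ℝ) ^ (-(n : ℝ) / 2)) *
            ((1 + (n : ℝ)) / (1 + (n : ℝ)) ^ 3) := by ring
        _ = _ := by
          rw [e2]
          field_simp
    simp only [ht]
    rw [← ENNReal.ofReal_tsum_of_nonneg (fun n => by positivity) (hsum.mul_left _), tsum_mul_left,
      ← hS]
    change _ = ENNReal.ofReal (2 * C * S) * R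
    rw [← ENNReal.ofReal_toReal hRt, ← ENNReal.ofReal_mul (by positivity)]
    congr 1
    ring
  have hrow : ∀ x, ∑' y, φ (G.dist x y) * w y ≤ ((2 * C * S).toNNReal : ℝ≥0∞) * R * w x := by
    intro x
    rw [← hφ]
    exact tsum_radial_le hG (by omega) hreg ω φ x
  obtain ⟨T, hT, hTn⟩ := exists_clm_of_schur (K := opKernel G q a) (w := w)
    (A := ((2 * C * S).toNNReal : ℝ≥0∞) * R)
    (fun x => (ENNReal.ofReal_pos.2 (by positivity)).ne') (fun x => ENNReal.ofReal_ne_top)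
    (ENNReal.mul_ne_top ENNReal.coe_ne_top hRt)
    (fun x => (ENNReal.tsum_le_tsum fun y => by gcongr; exact hKφ x y).trans (hrow x))
    (fun y => (ENNReal.tsum_le_tsum fun x => by
      gcongr
      exact (hKφ x y).trans (by rw [SimpleGraph.dist_comm])).trans (hrow y))
  refine ⟨T, fun u _ x => ?_, hTn⟩
  rw [hT, OP_eq_tsum_opKernel]
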